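/- All rings are commutative and Noetherian with identity. A ring $A$ satisfies the symmetric Auslander condition (SAC) if, for every finitely generated $A$-module $M$ such that $\operatorname{Ext}_A^i(M,A)=0$ for all $i>0$ and $\operatorname{Ext}_A^i(M,M)=0$ for all sufficiently large $i$, one has $\operatorname{Ext}_A^i(M,M)=0$ for all $i>0$. Theorem 4.8. Let $(R,\mathfrak m)$ be a Gorenstein local ring, let $n\ge 1$, and let $x_1,\dots,x_n$ be a regular sequence on $R$. Set $Q=(x_1,\dots,x_n)$. Then the following conditions are equivalent: 1. $R$ satisfies (SAC). 2. $R/Q$ satisfies (SAC). 3. $R/Q^\ell$ satisfies (SAC) for some integer $\ell>0$. 4. $R/Q^\ell$ satisfies (SAC) for all integers $1\le \ell\le n$. -/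

import Mathlib

open CategoryTheory

universe u

/-- A Gorenstein local ring: a (commutative) Noetherian local ring of finite injective dimension
as a module over itself. -/
class IsGorensteinLocalRing (R : Type u) [CommRing R] : Prop
    extends IsLocalRing R, IsNoetherianRing R where
  exists_hasInjectiveDimensionLE :
    ∃ d : ℕ, HasInjectiveDimensionLE (ModuleCat.of R R) d

/-- The symmetric Auslander condition (SAC): for each finitely generated `R`-module `M`, if
`Ext^i_R(M, R) = 0` for all `i > 0` and `Ext^i_R(M, M) = 0` for all large enough `i`, then
`Ext^i_R(M, M) = 0` for all `i > 0`. -/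
def SatisfiesSAC (R : Type u) [CommRing R] : Prop :=
  ∀ (M : Type u) [AddCommGroup M] [Module R M] [Module.Finite R M],
    (∀ i : ℕ, 0 < i → Subsingleton (Abelian.Ext (ModuleCat.of R M) (ModuleCat.of R R) i)) →
    (∃ N : ℕ, ∀ i : ℕ, N < i →
      Subsingleton (Abelian.Ext (ModuleCat.of R M) (ModuleCat.of R M) i)) →
    ∀ i : ℕ, 0 < i → Subsingleton (Abelian.Ext (ModuleCat.of R M) (ModuleCat.of R M) i)

/-! Since R is Gorenstein, Ext^i(-, R) vanishes above a fixed degree on finitely generated modules,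
and Rees's shift carries this to T = R/Q. If Ext^i(M, T) = 0 for all i > 0, duality into T makes M
Tor-independent of T (`IsExtAcyclic.ker_inf_smul_le`). As Q^j/Q^(j+1) is free over T
(`exists_isPowerBasis`), M is then also Tor-independent of R/Q^ℓ, Ext can be computed after base
change (`extVanishes_baseChange_iff`), and M/Q^ℓ M is an iterated extension of copies of M/QM.

From R to R/Q (`SatisfiesSAC.of_regular`): by induction, kill one regular element a, with B = A/(a).
To a test module N over B attach its first syzygy M over A. Rees's shift gives Ext(M, A) = 0, and 0
→ N → B ⊗ M → Ω_B N → 0 carries Ext vanishing from (N, N) to (M, M) and back.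

From R/Q^ℓ to R (`SatisfiesSAC.of_quotient_ofList_pow`): a test module M is base changed to R/Q^ℓ;
(SAC) there gives Ext(M, M/Q^ℓ M) = 0, descending induction on the degree gives Ext(M, M/QM) = 0,
and Nakayama gives Ext(M, M) = 0.

From R/Q to S = R/Q^ℓ with ℓ ≤ n (`SatisfiesSAC.of_nilpotent_ker`): S is filtered by powers of T,
and for ℓ ≤ n the last rank exceeds the sum of the others. So Ext(M, S) = 0 forces the local lengths
of Ext^i(M, T) to decrease strictly until they vanish (`IsIteratedExtension.extVanishes_of_last`).
The same count applied to M yields Ext^i(M, M/JM) = 0 for large i, where J = ker(S → T); then (SAC)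
over T applies to T ⊗ M. -/

/-! ### Vanishing of Ext along short exact sequences -/

section ExtVanishing

open Abelian

/-- `Ext^i_A(M, N) = 0`. -/
def ExtVanishes (A : Type u) [CommRing A] (M N : Type u) [AddCommGroup M] [Module A M]
    [AddCommGroup N] [Module A N] (i : ℕ) : Prop :=
  Subsingleton (Abelian.Ext (ModuleCat.of A M) (ModuleCat.of A N) i)

variable {A : Type u} [CommRing A]
variable {M : Type u} [AddCommGroup M] [Module A M]
variable {M₁ : Type u} [AddCommGroup M₁] [Module A M₁]
variable {M₂ : Type u} [AddCommGroup M₂] [Module A M₂]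
variable {M₃ : Type u} [AddCommGroup M₃] [Module A M₃]
variable {f : M₁ →ₗ[A] M₂} {g : M₂ →ₗ[A] M₃}

/-- The short complex of modules attached to a pair of linear maps forming an exact sequence. -/
abbrev moduleShortComplex (hfg : Function.Exact f g) : ShortComplex (ModuleCat.{u} A) :=
  ModuleCat.shortComplexOfCompEqZero f g hfg.linearMap_comp_eq_zero

theorem moduleShortComplex_shortExact (hf : Function.Injective f) (hfg : Function.Exact f g)
    (hg : Function.Surjective g) : (moduleShortComplex hfg).ShortExact :=
  ModuleCat.shortComplex_shortExact _ hfg hf hg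

theorem ExtVanishes.of_exact_right (hf : Function.Injective f) (hfg : Function.Exact f g)
    (hg : Function.Surjective g) {i : ℕ} (h₁ : ExtVanishes A M M₁ i) (h₃ : ExtVanishes A M M₃ i) :
    ExtVanishes A M M₂ i := by
  have hS := moduleShortComplex_shortExact hf hfg hg
  unfold ExtVanishes at *
  refine subsingleton_of_forall_eq 0 fun x => ?_
  obtain ⟨y, rfl⟩ := Ext.covariant_sequence_exact₂ (ModuleCat.of A M) hS x (h₃.elim _ _)
  rw [h₁.elim y 0, Ext.zero_comp]

theorem ExtVanishes.of_exact_right_quotient (hf : Function.Injective f)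
    (hfg : Function.Exact f g) (hg : Function.Surjective g) {i : ℕ} (h₂ : ExtVanishes A M M₂ i)
    (h₁ : ExtVanishes A M M₁ (i + 1)) : ExtVanishes A M M₃ i := by
  have hS := moduleShortComplex_shortExact hf hfg hg
  unfold ExtVanishes at *
  refine subsingleton_of_forall_eq 0 fun x => ?_
  obtain ⟨y, rfl⟩ := Ext.covariant_sequence_exact₃ (ModuleCat.of A M) hS x rfl (h₁.elim _ _)
  rw [h₂.elim y 0, Ext.zero_comp]

theorem ExtVanishes.of_exact_right_sub (hf : Function.Injective f)
    (hfg : Function.Exact f g) (hg : Function.Surjective g) {i : ℕ} (h₃ : ExtVanishes A M M₃ i)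
    (h₂ : ExtVanishes A M M₂ (i + 1)) : ExtVanishes A M M₁ (i + 1) := by
  have hS := moduleShortComplex_shortExact hf hfg hg
  unfold ExtVanishes at *
  refine subsingleton_of_forall_eq 0 fun x => ?_
  obtain ⟨y, rfl⟩ := Ext.covariant_sequence_exact₁ (ModuleCat.of A M) hS x (h₂.elim _ _) rfl
  rw [h₃.elim y 0, Ext.zero_comp]

theorem ExtVanishes.of_exact_left (hf : Function.Injective f) (hfg : Function.Exact f g)
    (hg : Function.Surjective g) {i : ℕ} (h₁ : ExtVanishes A M₁ M i) (h₃ : ExtVanishes A M₃ M i) :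
    ExtVanishes A M₂ M i := by
  have hS := moduleShortComplex_shortExact hf hfg hg
  unfold ExtVanishes at *
  refine subsingleton_of_forall_eq 0 fun x => ?_
  obtain ⟨y, rfl⟩ := Ext.contravariant_sequence_exact₂ hS (ModuleCat.of A M) x (h₁.elim _ _)
  rw [h₃.elim y 0, Ext.comp_zero]

theorem ExtVanishes.of_exact_left_sub (hf : Function.Injective f)
    (hfg : Function.Exact f g) (hg : Function.Surjective g) {i : ℕ} (h₂ : ExtVanishes A M₂ M i)
    (h₃ : ExtVanishes A M₃ M (i + 1)) : ExtVanishes A M₁ M i := by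
  have hS := moduleShortComplex_shortExact hf hfg hg
  unfold ExtVanishes at *
  refine subsingleton_of_forall_eq 0 fun x => ?_
  obtain ⟨y, rfl⟩ := Ext.contravariant_sequence_exact₁ hS (ModuleCat.of A M) x (add_comm 1 i)
    (h₃.elim _ _)
  rw [h₂.elim y 0, Ext.comp_zero]

theorem ExtVanishes.of_exact_left_quotient (hf : Function.Injective f)
    (hfg : Function.Exact f g) (hg : Function.Surjective g) {i : ℕ} (h₁ : ExtVanishes A M₁ M i)
    (h₂ : ExtVanishes A M₂ M (i + 1)) : ExtVanishes A M₃ M (i + 1) := by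
  have hS := moduleShortComplex_shortExact hf hfg hg
  unfold ExtVanishes at *
  refine subsingleton_of_forall_eq 0 fun x => ?_
  obtain ⟨y, rfl⟩ := Ext.contravariant_sequence_exact₃ hS (ModuleCat.of A M) x (h₂.elim _ _)
    (add_comm 1 i)
  rw [h₁.elim y 0, Ext.comp_zero]

theorem ExtVanishes.congr_right (e : M₁ ≃ₗ[A] M₂) {i : ℕ} (h : ExtVanishes A M M₁ i) :
    ExtVanishes A M M₂ i := by
  unfold ExtVanishes at *
  refine subsingleton_of_forall_eq 0 fun x => ?_
  have : x = (x.comp (Ext.mk₀ e.symm.toModuleIso.hom) (add_zero i)).comp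
      (Ext.mk₀ e.symm.toModuleIso.inv) (add_zero i) := by
    rw [Ext.comp_assoc_of_third_deg_zero, Ext.mk₀_comp_mk₀, Iso.hom_inv_id, Ext.comp_mk₀_id]
  rw [this, h.elim (x.comp (Ext.mk₀ e.symm.toModuleIso.hom) (add_zero i)) 0, Ext.zero_comp]

theorem ExtVanishes.of_projective [Module.Projective A M] {i : ℕ} (hi : 0 < i) :
    ExtVanishes A M M₁ i := by
  obtain ⟨i, rfl⟩ := Nat.exists_eq_succ_of_ne_zero hi.ne'
  have : Projective (ModuleCat.of A M) := (IsProjective.iff_projective (R := A) M).mp inferInstance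
  exact subsingleton_of_forall_eq 0 fun x => Ext.eq_zero_of_projective x

theorem ExtVanishes.of_subsingleton_right [Subsingleton M₁] {i : ℕ} :
    ExtVanishes A M M₁ i := by
  refine subsingleton_of_forall_eq 0 fun x => ?_
  rw [← Ext.comp_mk₀_id x]
  have : 𝟙 (ModuleCat.of A M₁) = 0 := by ext y; exact Subsingleton.elim (α := M₁) _ _
  rw [this, Ext.mk₀_zero, Ext.comp_zero]

theorem ExtVanishes.of_subsingleton_left [Subsingleton M] {i : ℕ} :
    ExtVanishes A M M₁ i := by
  refine subsingleton_of_forall_eq 0 fun x => ?_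
  rw [← Ext.mk₀_id_comp x]
  have : 𝟙 (ModuleCat.of A M) = 0 := by ext y; exact Subsingleton.elim (α := M) _ _
  rw [this, Ext.mk₀_zero, Ext.zero_comp]

theorem exact_single_zero_tail (A : Type u) [CommRing A] (N : Type u) [AddCommGroup N]
    [Module A N] (r : ℕ) :
    Function.Exact (LinearMap.single A (fun _ : Fin (r + 1) => N) 0)
      (LinearMap.funLeft A N (Fin.succ (n := r))) := by
  intro v
  constructor
  · intro h
    refine ⟨v 0, funext fun k => ?_⟩
    refine Fin.cases ?_ (fun k => ?_) k
    · simp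
    · have := congrFun h k
      simp only [LinearMap.funLeft_apply, Pi.zero_apply] at this
      simp [this]
  · rintro ⟨y, rfl⟩
    ext k
    simp

theorem funLeft_succ_surjective (A : Type u) [CommRing A] (N : Type u) [AddCommGroup N]
    [Module A N] (r : ℕ) :
    Function.Surjective (LinearMap.funLeft A N (Fin.succ (n := r))) :=
  LinearMap.funLeft_surjective_of_injective A N _ (Fin.succ_injective r)

theorem single_injective (A : Type u) [CommRing A] (N : Type u) [AddCommGroup N]
    [Module A N] (r : ℕ) :
    Function.Injective (LinearMap.single A (fun _ : Fin (r + 1) => N) 0) :=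
  Pi.single_injective (M := fun _ : Fin (r + 1) => N) 0

theorem ExtVanishes.pi_right {i : ℕ} (h : ExtVanishes A M M₁ i) (r : ℕ) :
    ExtVanishes A M (Fin r → M₁) i := by
  induction r with
  | zero => exact .of_subsingleton_right
  | succ r ih =>
    exact .of_exact_right (single_injective A M₁ r) (exact_single_zero_tail A M₁ r)
      (funLeft_succ_surjective A M₁ r) h ih

theorem ExtVanishes.pi_left {i : ℕ} (h : ExtVanishes A M₁ M i) (r : ℕ) :
    ExtVanishes A (Fin r → M₁) M i := by
  induction r with
  | zero => exact .of_subsingleton_left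
  | succ r ih =>
    exact .of_exact_left (single_injective A M₁ r) (exact_single_zero_tail A M₁ r)
      (funLeft_succ_surjective A M₁ r) h ih

/-- `Ext¹` vanishes if every map from the first syzygy extends to the projective cover. -/
theorem ExtVanishes.one_of_exists_extension [Module.Projective A M₂] (hf : Function.Injective f)
    (hfg : Function.Exact f g) (hg : Function.Surjective g)
    (h : ∀ φ : M₁ →ₗ[A] M, ∃ ψ : M₂ →ₗ[A] M, ψ ∘ₗ f = φ) : ExtVanishes A M₃ M 1 := by
  have hS := moduleShortComplex_shortExact hf hfg hg
  refine subsingleton_of_forall_eq 0 fun x => ?_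
  obtain ⟨y, rfl⟩ := Ext.contravariant_sequence_exact₃ hS (ModuleCat.of A M) x
    ((ExtVanishes.of_projective (M₁ := M) (M := M₂) one_pos).elim _ _) (add_comm 1 0)
  obtain ⟨φ, rfl⟩ := Ext.addEquiv₀.symm.surjective y
  obtain ⟨ψ, hψ⟩ := h φ.hom
  have : Ext.addEquiv₀.symm φ =
      (Ext.mk₀ (moduleShortComplex hfg).f).comp (Ext.mk₀ (ModuleCat.ofHom ψ)) (zero_add 0) := by
    rw [Ext.mk₀_comp_mk₀]
    change Ext.mk₀ φ = _
    congr 1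
    ext x
    exact (LinearMap.congr_fun hψ x).symm
  rw [this]
  exact hS.extClass_comp_assoc _

/-- If `Ext¹` of the cokernel vanishes then maps extend along a monomorphism. -/
theorem ExtVanishes.exists_extension (hf : Function.Injective f)
    (hfg : Function.Exact f g) (hg : Function.Surjective g) (h : ExtVanishes A M₃ M 1)
    (φ : M₁ →ₗ[A] M) : ∃ ψ : M₂ →ₗ[A] M, ψ ∘ₗ f = φ := by
  have hS := moduleShortComplex_shortExact hf hfg hg
  obtain ⟨y, hy⟩ := Ext.contravariant_sequence_exact₁ hS (ModuleCat.of A M)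
    (Ext.mk₀ (ModuleCat.ofHom φ)) (add_comm 1 0) (Subsingleton.elim (h := h) _ _)
  obtain ⟨ψ, rfl⟩ := Ext.addEquiv₀.symm.surjective y
  refine ⟨ψ.hom, ?_⟩
  change (Ext.mk₀ _).comp (Ext.mk₀ ψ) _ = _ at hy
  rw [Ext.mk₀_comp_mk₀] at hy
  have := (Ext.mk₀_bijective _ _).1 hy
  ext x
  exact congrArg (fun k => k.hom x) this

theorem ExtVanishes.of_syzygy [Module.Projective A M₂] (hf : Function.Injective f)
    (hfg : Function.Exact f g) (hg : Function.Surjective g) {i : ℕ}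
    (h : ExtVanishes A M₁ M (i + 1)) : ExtVanishes A M₃ M (i + 2) :=
  h.of_exact_left_quotient hf hfg hg (.of_projective (by omega))

theorem ExtVanishes.syzygy [Module.Projective A M₂] (hf : Function.Injective f)
    (hfg : Function.Exact f g) (hg : Function.Surjective g) {i : ℕ}
    (h : ExtVanishes A M₃ M (i + 2)) : ExtVanishes A M₁ M (i + 1) :=
  .of_exact_left_sub hf hfg hg (.of_projective (by omega)) h

/-- Nakayama's lemma for `Ext`: it vanishes if it does so modulo a regular element. -/
theorem ExtVanishes.of_quotSMulTop [IsLocalRing A] [IsNoetherianRing A] [Module.Finite A M]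
    [Module.Finite A M₁] {a : A} (ha : a ∈ IsLocalRing.maximalIdeal A) (hreg : IsSMulRegular M₁ a)
    {i : ℕ} (h : ExtVanishes A M (QuotSMulTop a M₁) i) : ExtVanishes A M M₁ i := by
  have hS := hreg.smulShortComplex_shortExact (M := ModuleCat.of A M₁)
  let E := Abelian.Ext (ModuleCat.of A M) (ModuleCat.of A M₁) i
  -- The long exact sequence of multiplication by a makes a surjective on Ext^i, which is finitely
  -- generated.
  have hE : ∀ x : E, ∃ y : E, a • y = x := by
    intro x
    obtain ⟨y, hy⟩ := Ext.covariant_sequence_exact₂ (ModuleCat.of A M) hS x (h.elim _ _)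
    refine ⟨y, ?_⟩
    rw [← hy, ModuleCat.smulShortComplex_f_eq_smul_id]
    exact Ext.smul_eq_comp_mk₀ y a
  have htop : (⊤ : Submodule A E) ≤ IsLocalRing.maximalIdeal A • ⊤ := by
    intro x _
    obtain ⟨y, rfl⟩ := hE x
    exact Submodule.smul_mem_smul ha trivial
  have hbot := Submodule.eq_bot_of_le_smul_of_le_jacobson_bot (IsLocalRing.maximalIdeal A)
    (⊤ : Submodule A E) (Module.Finite.fg_top) htop (IsLocalRing.maximalIdeal_le_jacobson _)
  exact (Submodule.subsingleton_iff A).mp (subsingleton_of_bot_eq_top hbot.symm)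

end ExtVanishing

/-! ### Maps out of quotients and free modules -/

section FreeModule

theorem LinearMap.exists_comp_eq_of_ker_le {A : Type*} [Ring A] {M N P : Type*} [AddCommGroup M]
    [AddCommGroup N] [AddCommGroup P] [Module A M] [Module A N] [Module A P] {p : M →ₗ[A] N}
    (hp : Function.Surjective p) {h : M →ₗ[A] P} (hker : LinearMap.ker p ≤ LinearMap.ker h) :
    ∃ h' : N →ₗ[A] P, h' ∘ₗ p = h := by
  refine ⟨(LinearMap.ker p).liftQ h hker ∘ₗ (p.quotKerEquivOfSurjective hp).symm.toLinearMap, ?_⟩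
  ext m
  have : (p.quotKerEquivOfSurjective hp).symm (p m) = (LinearMap.ker p).mkQ m :=
    (LinearEquiv.symm_apply_eq _).mpr rfl
  simp only [LinearMap.comp_apply, LinearEquiv.coe_coe, this]
  rfl

theorem Submodule.smul_top_le_ker_of_algebra {A B : Type*} [CommRing A] [CommRing B] [Algebra A B]
    {M N : Type*} [AddCommGroup M] [AddCommGroup N] [Module A M] [Module A N] [Module B N]
    [IsScalarTower A B N] (h : M →ₗ[A] N) :
    RingHom.ker (algebraMap A B) • (⊤ : Submodule A M) ≤ LinearMap.ker h :=
  Submodule.smul_le.mpr fun a ha w _ => by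
    rw [LinearMap.mem_ker, map_smul, ← algebraMap_smul B, RingHom.mem_ker.mp ha, zero_smul]

theorem mem_ideal_smul_top_pi {A : Type u} [CommRing A] (I : Ideal A) {r : ℕ} (v : Fin r → A) :
    v ∈ I • (⊤ : Submodule A (Fin r → A)) ↔ ∀ k, v k ∈ I := by
  constructor
  · intro hv k
    have : (I • (⊤ : Submodule A (Fin r → A))).map (LinearMap.proj k) ≤ I := by
      rw [Submodule.map_smul'']
      exact Submodule.smul_le.mpr fun a ha b _ => I.mul_mem_right b ha
    exact this (Submodule.mem_map_of_mem hv)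
  · intro hv
    rw [pi_eq_sum_univ' v]
    exact Submodule.sum_mem _ fun k _ => Submodule.smul_mem_smul (hv k) trivial

end FreeModule

/-! ### Duality into B and Tor-independence -/

section Duality

variable {A B : Type u} [CommRing A] [CommRing B] [Algebra A B]

/-- The functors `Ext^i_B(-, B)` vanish on finitely generated modules for `i > d`. -/
def SelfExtBoundedBy (B : Type u) [CommRing B] (d : ℕ) : Prop :=
  ∀ (N : Type u) [AddCommGroup N] [Module B N] [Module.Finite B N] (i : ℕ), d < i →
    ExtVanishes B N B i

/-- All higher `Ext`-modules from `M` to the `A`-algebra `B` vanish. -/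
def IsExtAcyclic (A B : Type u) [CommRing A] [CommRing B] [Algebra A B] (M : Type u)
    [AddCommGroup M] [Module A M] : Prop :=
  ∀ i, 0 < i → ExtVanishes A M B i

variable {M : Type u} [AddCommGroup M] [Module A M] {r : ℕ} (π : (Fin r → A) →ₗ[A] M)

theorem IsExtAcyclic.ker (hM : IsExtAcyclic A B M) (hπ : Function.Surjective π) :
    IsExtAcyclic A B (LinearMap.ker π) := by
  intro i hi
  obtain ⟨i, rfl⟩ := Nat.exists_eq_succ_of_ne_zero hi.ne'
  exact (hM (i + 2) (by omega)).syzygy (Submodule.subtype_injective _)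
    (LinearMap.exact_subtype_ker_map π) hπ

theorem IsExtAcyclic.exists_extension (hM : IsExtAcyclic A B M) (hπ : Function.Surjective π)
    (h : LinearMap.ker π →ₗ[A] B) :
    ∃ h' : (Fin r → A) →ₗ[A] B, h' ∘ₗ (LinearMap.ker π).subtype = h :=
  (hM 1 one_pos).exists_extension (Submodule.subtype_injective _)
    (LinearMap.exact_subtype_ker_map π) hπ h

theorem lcomp_injective (hπ : Function.Surjective π) :
    Function.Injective (LinearMap.lcomp B B π) := by
  intro h₁ h₂ h
  ext m
  obtain ⟨v, rfl⟩ := hπ m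
  exact LinearMap.congr_fun h v

/-- Together with `IsExtAcyclic.exists_extension` this dualizes 0 → ker π → A^r → M → 0 to a short
exact sequence over B with free middle term. -/
theorem lcomp_exact (hπ : Function.Surjective π) :
    Function.Exact (LinearMap.lcomp B B π) (LinearMap.lcomp B B (LinearMap.ker π).subtype) := by
  intro h
  constructor
  · intro hh
    have hk : LinearMap.ker π ≤ LinearMap.ker h := fun k hk =>
      LinearMap.congr_fun hh (⟨k, hk⟩ : LinearMap.ker π)
    exact LinearMap.exists_comp_eq_of_ker_le hπ hk
  · rintro ⟨h, rfl⟩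
    ext k
    have : π k.1 = 0 := k.2
    simp [this]

instance finite_dual [IsNoetherianRing B] [Module.Finite A M] : Module.Finite B (M →ₗ[A] B) := by
  obtain ⟨r, π, hπ⟩ := Module.Finite.exists_fin' A M
  have := Module.Finite.equiv ((Pi.basisFun A (Fin r)).constr (M' := B) B)
  exact Module.Finite.of_injective _ (lcomp_injective (B := B) π hπ)

/-- The dualized presentation reduces Ext^i of the dual of M to Ext^(i+1) of the dual of its syzygy.
Each of the k syzygies thus lowers the bound d by one. -/
theorem dual_extVanishes_aux [IsNoetherianRing A] [IsNoetherianRing B] {d : ℕ}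
    (hB : SelfExtBoundedBy B d) (k : ℕ) (hk : k ≤ d) (M : Type u) [AddCommGroup M] [Module A M]
    [Module.Finite A M] (hM : IsExtAcyclic A B M) (i : ℕ) (hi : d - k < i) :
    ExtVanishes B (M →ₗ[A] B) B i := by
  induction k generalizing M i with
  | zero => exact hB _ i (by omega)
  | succ k ih =>
    obtain ⟨r, π, hπ⟩ := Module.Finite.exists_fin' A M
    have := Module.Projective.of_equiv ((Pi.basisFun A (Fin r)).constr (M' := B) B)
    have hsurj : Function.Surjective (LinearMap.lcomp B B (LinearMap.ker π).subtype) :=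
      fun h => hM.exists_extension π hπ h
    exact .of_exact_left_sub (lcomp_injective π hπ) (lcomp_exact π hπ) hsurj
      (.of_projective (by omega)) (ih (by omega) _ (hM.ker π hπ) (i + 1) (by omega))

theorem IsExtAcyclic.dual [IsNoetherianRing A] [IsNoetherianRing B] [Module.Finite A M] {d : ℕ}
    (hB : SelfExtBoundedBy B d) (hM : IsExtAcyclic A B M) :
    ∀ i, 0 < i → ExtVanishes B (M →ₗ[A] B) B i :=
  fun i hi => dual_extVanishes_aux hB d le_rfl M hM i (by omega)

variable [IsNoetherianRing A] [IsNoetherianRing B] {d : ℕ}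

/-- Ext^1 of the dual of the syzygy vanishes, so φ extends to the dual of A^r. There a functional is
evaluation at a vector of B^r, which lifts to A^r and is then pushed to M. -/
theorem IsExtAcyclic.eval_surjective [Module.Finite A M]
    (hAB : Function.Surjective (algebraMap A B))
    (hB : SelfExtBoundedBy B d) (hM : IsExtAcyclic A B M)
    (φ : (M →ₗ[A] B) →ₗ[B] B) : ∃ m : M, ∀ h : M →ₗ[A] B, φ h = h m := by
  obtain ⟨r, π, hπ⟩ := Module.Finite.exists_fin' A M
  have hsurj : Function.Surjective (LinearMap.lcomp B B (LinearMap.ker π).subtype) :=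
    fun h => hM.exists_extension π hπ h
  obtain ⟨ψ, hψ⟩ := ((hM.ker π hπ).dual hB 1 one_pos).exists_extension
    (lcomp_injective π hπ) (lcomp_exact π hπ) hsurj φ
  let e := (Pi.basisFun A (Fin r)).constr (M' := B) B
  choose a ha using fun k => hAB (ψ (e (Pi.single k 1)))
  refine ⟨π a, fun h => ?_⟩
  have h1 : φ h = ψ (h ∘ₗ π) := (LinearMap.congr_fun hψ h).symm
  have h2 : h ∘ₗ π = e fun k => h (π (Pi.single k 1)) := by
    refine (Pi.basisFun A (Fin r)).ext fun k => ?_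
    rw [Module.Basis.constr_basis]
    simp
  have h3 : h (π a) = ∑ k, h (π (Pi.single k 1)) * ψ (e (Pi.single k 1)) := by
    conv_lhs => rw [pi_eq_sum_univ' a]
    simp only [map_sum, map_smul, ← ha]
    exact Finset.sum_congr rfl fun k _ => by rw [Algebra.smul_def, mul_comm]
  rw [h1, h2, h3, pi_eq_sum_univ' fun k => h (π (Pi.single k 1))]
  simp only [map_sum, map_smul, smul_eq_mul]

/-- An element of an acyclic module killed by all functionals lies in `ker(A → B) • M`. -/
theorem IsExtAcyclic.mem_smul_top_of_forall_eq_zero [Module.Finite A M]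
    (hAB : Function.Surjective (algebraMap A B))
    (hB : SelfExtBoundedBy B d) (hM : IsExtAcyclic A B M) {m : M}
    (hm : ∀ h : M →ₗ[A] B, h m = 0) :
    m ∈ RingHom.ker (algebraMap A B) • (⊤ : Submodule A M) := by
  obtain ⟨r, π, hπ⟩ := Module.Finite.exists_fin' A M
  obtain ⟨v, rfl⟩ := hπ m
  have hsurj : Function.Surjective (LinearMap.lcomp B B (LinearMap.ker π).subtype) :=
    fun h => hM.exists_extension π hπ h
  let ev : ((Fin r → A) →ₗ[A] B) →ₗ[B] B := LinearMap.applyₗ' B v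
  -- Evaluation at v kills the functionals that come from M, so it factors through the dual of the
  -- syzygy, where it is evaluation at some k. Comparing coordinates puts v - k in I • A^r.
  have hev : LinearMap.ker (LinearMap.lcomp B B (LinearMap.ker π).subtype) ≤ LinearMap.ker ev := by
    intro h hh
    obtain ⟨h', rfl⟩ := (lcomp_exact (B := B) π hπ h).mp hh
    exact hm h'
  obtain ⟨χ, hχ⟩ := LinearMap.exists_comp_eq_of_ker_le hsurj hev
  obtain ⟨k, hk⟩ := (hM.ker π hπ).eval_surjective hAB hB χ
  have hvk : ∀ h : (Fin r → A) →ₗ[A] B, h v = h k.1 := by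
    intro h
    exact (LinearMap.congr_fun hχ h).symm.trans
      (hk (LinearMap.lcomp B B (LinearMap.ker π).subtype h))
  have hmem : v - k.1 ∈ RingHom.ker (algebraMap A B) • (⊤ : Submodule A (Fin r → A)) := by
    rw [mem_ideal_smul_top_pi]
    intro j
    have := hvk (Algebra.linearMap A B ∘ₗ LinearMap.proj j)
    rw [RingHom.mem_ker, Pi.sub_apply, map_sub, sub_eq_zero]
    simpa using this
  have : π v = π (v - k.1) := by rw [map_sub, show π k.1 = 0 from k.2, sub_zero]
  rw [this]
  have h := Submodule.mem_map_of_mem (f := π) hmem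
  rw [Submodule.map_smul''] at h
  exact Submodule.smul_mono le_rfl le_top h

/-- Tor-independence: an acyclic module has injective syzygy after base change to `B`. -/
theorem IsExtAcyclic.ker_inf_smul_le (hAB : Function.Surjective (algebraMap A B))
    (hB : SelfExtBoundedBy B d) (hM : IsExtAcyclic A B M) (hπ : Function.Surjective π) :
    LinearMap.ker π ⊓ RingHom.ker (algebraMap A B) • ⊤ ≤
      RingHom.ker (algebraMap A B) • LinearMap.ker π := by
  rintro k ⟨hk, hkI⟩
  have : (⟨k, hk⟩ : LinearMap.ker π) ∈
      RingHom.ker (algebraMap A B) • (⊤ : Submodule A (LinearMap.ker π)) := by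
    -- A functional on the syzygy extends to A^r, and there it kills I • A^r.
    refine (hM.ker π hπ).mem_smul_top_of_forall_eq_zero hAB hB fun h => ?_
    obtain ⟨h', rfl⟩ := hM.exists_extension π hπ h
    change h' k = 0
    exact Submodule.smul_top_le_ker_of_algebra h' hkI
  have h := Submodule.mem_map_of_mem (f := (LinearMap.ker π).subtype) this
  rwa [Submodule.map_smul'', Submodule.map_subtype_top] at h

/-- Functionals into B separate the points of M/IM, so regularity on B passes to M/IM. -/
theorem IsExtAcyclic.mem_smul_top_of_smul_mem [Module.Finite A M]
    (hAB : Function.Surjective (algebraMap A B))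
    (hB : SelfExtBoundedBy B d) (hM : IsExtAcyclic A B M) {a : A} (ha : IsSMulRegular B a) {m : M}
    (hm : a • m ∈ RingHom.ker (algebraMap A B) • (⊤ : Submodule A M)) :
    m ∈ RingHom.ker (algebraMap A B) • (⊤ : Submodule A M) := by
  refine hM.mem_smul_top_of_forall_eq_zero hAB hB fun h => ha ?_
  have := Submodule.smul_top_le_ker_of_algebra h hm
  rw [LinearMap.mem_ker, map_smul] at this
  simpa using this

end Duality

/-! ### Change of rings for Ext along a surjection -/

section BaseChange

variable {A B : Type u} [CommRing A] [CommRing B] [Algebra A B]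

/-- `Tor`-independence of `M` and `A ⧸ I` in degrees `1, …, k`, expressed by syzygies. -/
def IsTorIndependent {A : Type u} [CommRing A] (I : Ideal A) :
    ℕ → ∀ (M : Type u) [AddCommGroup M] [Module A M], Prop
  | 0, _, _, _ => True
  | k + 1, M, _, _ => ∀ (r : ℕ) (π : (Fin r → A) →ₗ[A] M), Function.Surjective π →
      LinearMap.ker π ⊓ I • ⊤ ≤ I • LinearMap.ker π ∧ IsTorIndependent I k (LinearMap.ker π)

variable {M : Type u} [AddCommGroup M] [Module A M]
variable {MB : Type u} [AddCommGroup MB] [Module A MB] [Module B MB] [IsScalarTower A B MB]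
variable {N : Type u} [AddCommGroup N] [Module A N] [Module B N] [IsScalarTower A B N]

/-- The two conditions on `p` identify MB with M/IM. Phrased this way, tensor products, syzygies and
B-modules such as N itself can all serve as base changes. -/
theorem LinearMap.exists_descend (hAB : Function.Surjective (algebraMap A B)) {p : M →ₗ[A] MB}
    (hp : Function.Surjective p)
    (hker : LinearMap.ker p ≤ RingHom.ker (algebraMap A B) • ⊤) (h : M →ₗ[A] N) :
    ∃ h' : MB →ₗ[B] N, ∀ m, h' (p m) = h m := by
  obtain ⟨h', hh'⟩ := LinearMap.exists_comp_eq_of_ker_le hp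
    (hker.trans (Submodule.smul_top_le_ker_of_algebra (B := B) h))
  exact ⟨h'.extendScalarsOfSurjective hAB, fun m => LinearMap.congr_fun hh' m⟩

theorem ker_compLeft_linearMap (r : ℕ) :
    LinearMap.ker ((Algebra.linearMap A B).compLeft (Fin r)) =
      RingHom.ker (algebraMap A B) • (⊤ : Submodule A (Fin r → A)) := by
  ext v
  rw [mem_ideal_smul_top_pi, LinearMap.mem_ker]
  exact funext_iff

variable {p : M →ₗ[A] MB} {r : ℕ} (π : (Fin r → A) →ₗ[A] M)

/-- The presentation of a base change induced by a presentation. -/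
noncomputable def baseChangePresentation (p : M →ₗ[A] MB) (π : (Fin r → A) →ₗ[A] M) :
    (Fin r → B) →ₗ[B] MB :=
  (Pi.basisFun B (Fin r)).constr B fun k => p (π (Pi.single k 1))

theorem baseChangePresentation_apply (v : Fin r → A) :
    baseChangePresentation p π ((Algebra.linearMap A B).compLeft (Fin r) v) = p (π v) := by
  conv_rhs => rw [pi_eq_sum_univ' v]
  simp [baseChangePresentation, Module.Basis.constr_apply_fintype]

theorem compLeft_linearMap_surjective (hAB : Function.Surjective (algebraMap A B)) (r : ℕ) :
    Function.Surjective ((Algebra.linearMap A B).compLeft (Fin r)) := fun w =>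
  ⟨fun k => (hAB (w k)).choose, funext fun k => (hAB (w k)).choose_spec⟩

theorem baseChangePresentation_surjective (hp : Function.Surjective p)
    (hπ : Function.Surjective π) :
    Function.Surjective (baseChangePresentation (B := B) p π) := by
  intro y
  obtain ⟨m, rfl⟩ := hp y
  obtain ⟨v, rfl⟩ := hπ m
  exact ⟨_, baseChangePresentation_apply π v⟩

/-- The map from a syzygy to the syzygy of the base change. -/
noncomputable def syzygyBaseChange (p : M →ₗ[A] MB) (π : (Fin r → A) →ₗ[A] M) :
    LinearMap.ker π →ₗ[A] LinearMap.ker (baseChangePresentation (B := B) p π) where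
  toFun k := ⟨(Algebra.linearMap A B).compLeft (Fin r) k, by
    rw [LinearMap.mem_ker, baseChangePresentation_apply, show π k = 0 from k.2, map_zero]⟩
  map_add' x y := Subtype.ext (by simp)
  map_smul' a x := Subtype.ext (by simp)

theorem syzygyBaseChange_surjective (hAB : Function.Surjective (algebraMap A B))
    (hker : LinearMap.ker p ≤ RingHom.ker (algebraMap A B) • ⊤) (hπ : Function.Surjective π) :
    Function.Surjective (syzygyBaseChange (B := B) p π) := by
  rintro ⟨w, hw⟩
  obtain ⟨v, rfl⟩ := compLeft_linearMap_surjective hAB r w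
  rw [LinearMap.mem_ker, baseChangePresentation_apply] at hw
  have hv : π v ∈ RingHom.ker (algebraMap A B) • (⊤ : Submodule A M) := hker hw
  rw [← LinearMap.range_eq_top.mpr hπ, LinearMap.range_eq_map, ← Submodule.map_smul''] at hv
  obtain ⟨u, hu, huv⟩ := hv
  refine ⟨⟨v - u, by rw [LinearMap.mem_ker, map_sub, huv, sub_self]⟩, Subtype.ext ?_⟩
  have : (Algebra.linearMap A B).compLeft (Fin r) u = 0 := by
    rwa [← LinearMap.mem_ker, ker_compLeft_linearMap]
  change (Algebra.linearMap A B).compLeft (Fin r) (v - u) = _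
  rw [map_sub, this, sub_zero]

/-- This is where Tor-independence enters: the syzygy of the base change is the base change of the
syzygy. -/
theorem ker_syzygyBaseChange_le
    (htor : LinearMap.ker π ⊓ RingHom.ker (algebraMap A B) • ⊤ ≤
      RingHom.ker (algebraMap A B) • LinearMap.ker π) :
    LinearMap.ker (syzygyBaseChange (B := B) p π) ≤ RingHom.ker (algebraMap A B) • ⊤ := by
  rintro ⟨k, hk⟩ h
  have h0 : (Algebra.linearMap A B).compLeft (Fin r) k = 0 := congrArg Subtype.val h
  rw [← LinearMap.mem_ker, ker_compLeft_linearMap] at h0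
  have h1 := htor ⟨hk, h0⟩
  rw [← Submodule.map_subtype_top (LinearMap.ker π), ← Submodule.map_smul''] at h1
  obtain ⟨k', hk', rfl⟩ := h1
  exact hk'

/-- Change of rings for `Ext` along a surjection, for `Tor`-independent modules. -/
theorem extVanishes_baseChange_iff [IsNoetherianRing A]
    (hAB : Function.Surjective (algebraMap A B)) (i : ℕ) (M : Type u)
    [AddCommGroup M] [Module A M] [Module.Finite A M]
    (htor : IsTorIndependent (RingHom.ker (algebraMap A B)) (i + 1) M)
    (MB : Type u) [AddCommGroup MB] [Module A MB] [Module B MB] [IsScalarTower A B MB]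
    (p : M →ₗ[A] MB) (hp : Function.Surjective p)
    (hker : LinearMap.ker p ≤ RingHom.ker (algebraMap A B) • ⊤) :
    ExtVanishes B MB N (i + 1) ↔ ExtVanishes A M N (i + 1) := by
  induction i generalizing M MB with
  | zero =>
    obtain ⟨r, π, hπ⟩ := Module.Finite.exists_fin' A M
    obtain ⟨htor₁, htor₂⟩ := htor r π hπ
    have hq := syzygyBaseChange_surjective (p := p) π hAB hker hπ
    have hqker := ker_syzygyBaseChange_le (p := p) π htor₁
    have hπB := baseChangePresentation_surjective (B := B) π hp hπ
    -- Ext^1 is the obstruction to extending maps from the syzygy, and by descent the extension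
    -- problems over A and over B are the same.
    constructor
    · intro h
      refine .one_of_exists_extension (Submodule.subtype_injective _)
        (LinearMap.exact_subtype_ker_map π) hπ fun φ => ?_
      obtain ⟨φB, hφB⟩ := LinearMap.exists_descend hAB hq hqker φ
      obtain ⟨ψB, hψB⟩ := h.exists_extension (Submodule.subtype_injective _)
        (LinearMap.exact_subtype_ker_map _) hπB φB
      refine ⟨ψB.restrictScalars A ∘ₗ (Algebra.linearMap A B).compLeft (Fin r), ?_⟩
      ext k
      rw [← hφB, ← hψB]
      rfl
    · intro h
      refine .one_of_exists_extension (Submodule.subtype_injective _)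
        (LinearMap.exact_subtype_ker_map _) hπB fun φB => ?_
      obtain ⟨ψ, hψ⟩ := h.exists_extension (Submodule.subtype_injective _)
        (LinearMap.exact_subtype_ker_map π) hπ (φB.restrictScalars A ∘ₗ syzygyBaseChange p π)
      obtain ⟨ψB, hψB⟩ := LinearMap.exists_descend hAB (compLeft_linearMap_surjective hAB r)
        (ker_compLeft_linearMap r).le ψ
      refine ⟨ψB, ?_⟩
      ext k
      obtain ⟨k, rfl⟩ := hq k
      exact (hψB k).trans (LinearMap.congr_fun hψ k)
  | succ i ih =>
    obtain ⟨r, π, hπ⟩ := Module.Finite.exists_fin' A M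
    obtain ⟨htor₁, htor₂⟩ := htor r π hπ
    have hq := syzygyBaseChange_surjective (p := p) π hAB hker hπ
    have hqker := ker_syzygyBaseChange_le (p := p) π htor₁
    have hπB := baseChangePresentation_surjective (B := B) π hp hπ
    have key := ih (LinearMap.ker π) htor₂ (LinearMap.ker (baseChangePresentation (B := B) p π))
      (syzygyBaseChange p π) hq hqker
    constructor
    · intro h
      refine .of_syzygy (Submodule.subtype_injective _) (LinearMap.exact_subtype_ker_map π) hπ
        (key.mp (h.syzygy (Submodule.subtype_injective _) (LinearMap.exact_subtype_ker_map _) hπB))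
    · intro h
      refine .of_syzygy (Submodule.subtype_injective _) (LinearMap.exact_subtype_ker_map _) hπB
        (key.mpr (h.syzygy (Submodule.subtype_injective _) (LinearMap.exact_subtype_ker_map π) hπ))

theorem IsExtAcyclic.isTorIndependent [IsNoetherianRing A] [IsNoetherianRing B] {d : ℕ}
    (hAB : Function.Surjective (algebraMap A B)) (hB : SelfExtBoundedBy B d) (k : ℕ) (M : Type u)
    [AddCommGroup M] [Module A M] (hM : IsExtAcyclic A B M) :
    IsTorIndependent (RingHom.ker (algebraMap A B)) k M := by
  induction k generalizing M with
  | zero => trivial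
  | succ k ih =>
    exact fun r π hπ => ⟨hM.ker_inf_smul_le π hAB hB hπ, ih _ (hM.ker π hπ)⟩

theorem isTorIndependent_bot (k : ℕ) (M : Type u) [AddCommGroup M] [Module A M] :
    IsTorIndependent (⊥ : Ideal A) k M := by
  induction k generalizing M with
  | zero => trivial
  | succ k ih => exact fun r π hπ => ⟨by simp, ih _⟩

open TensorProduct in
-- Tensoring I → A → B with M is exact, and I ⊗ M has image IM in M.
theorem ker_mk_one_le (hAB : Function.Surjective (algebraMap A B)) (M : Type u) [AddCommGroup M]
    [Module A M] :
    LinearMap.ker (TensorProduct.mk A B M 1) ≤ RingHom.ker (algebraMap A B) • ⊤ := by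
  intro m hm
  have hex : Function.Exact (RingHom.ker (algebraMap A B)).subtype (Algebra.linearMap A B) := by
    intro a
    simp [RingHom.mem_ker]
  have h := rTensor_exact M hex hAB
  have h1 : (Algebra.linearMap A B).rTensor M (1 ⊗ₜ m) = 0 := by
    simpa using hm
  obtain ⟨t, ht⟩ := (h _).mp h1
  have h2 : m = TensorProduct.lid A M
      ((RingHom.ker (algebraMap A B)).subtype.rTensor M t) := by
    rw [ht]; simp
  rw [h2]
  clear h2 ht
  induction t with
  | zero => simp
  | tmul a m =>
    simpa using Submodule.smul_mem_smul a.2 (Submodule.mem_top (x := m))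
  | add x y hx hy => simpa using Submodule.add_mem _ hx hy

theorem TensorProduct.mk_one_surjective_of_surjective (hAB : Function.Surjective (algebraMap A B)) (M : Type u)
    [AddCommGroup M] [Module A M] : Function.Surjective (TensorProduct.mk A B M 1) :=
  TensorProduct.mk_surjective A M B hAB

end BaseChange

/-! ### Rees's shift modulo a regular element -/

section Rees

open Abelian

variable {A B : Type u} [CommRing A] [CommRing B] [Algebra A B]

theorem lsmul_injective_of_isSMulRegular {A : Type*} [CommRing A] {N : Type*} [AddCommGroup N]
    [Module A N] {a : A} (ha : IsSMulRegular N a) : Function.Injective (LinearMap.lsmul A N a) :=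
  fun _ _ h => ha h

theorem exact_lsmul_algebraLinearMap {a : A}
    (hker : RingHom.ker (algebraMap A B) = Ideal.span {a}) :
    Function.Exact (LinearMap.lsmul A A a) (Algebra.linearMap A B) := by
  intro x
  rw [Algebra.linearMap_apply, ← RingHom.mem_ker, hker, Ideal.mem_span_singleton']
  constructor
  · rintro ⟨b, rfl⟩
    exact ⟨b, mul_comm _ _⟩
  · rintro ⟨b, rfl⟩
    exact ⟨b, mul_comm _ _⟩

/-- Multiplication by a resolves B by projectives in length one. -/
theorem extVanishes_algebra_self {a : A} (hAB : Function.Surjective (algebraMap A B))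
    (hker : RingHom.ker (algebraMap A B) = Ideal.span {a}) (ha : IsSMulRegular A a) (i : ℕ) :
    ExtVanishes A B A (i + 2) :=
  .of_exact_left_quotient (lsmul_injective_of_isSMulRegular ha) (exact_lsmul_algebraLinearMap hker)
    hAB (.of_projective (by omega)) (.of_projective (by omega))

variable {K : Type u} [AddCommGroup K] [Module A K] [Module B K] [IsScalarTower A B K]

theorem smul_eq_zero_of_mem_ker_algebraMap {a : A} (ha : a ∈ RingHom.ker (algebraMap A B))
    (k : K) : a • k = 0 := by
  rw [← algebraMap_smul B, RingHom.mem_ker.mp ha, zero_smul]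

/-- Since a kills K, it kills Ext^1(K, A), so the connecting map from Hom(K, B) is onto. -/
theorem exists_comp_extClass_eq {a : A} (hAB : Function.Surjective (algebraMap A B))
    (hker : RingHom.ker (algebraMap A B) = Ideal.span {a}) (ha : IsSMulRegular A a)
    (x : Ext (ModuleCat.of A K) (ModuleCat.of A A) 1) :
    ∃ φ : K →ₗ[A] B, (Ext.mk₀ (ModuleCat.ofHom φ)).comp (moduleShortComplex_shortExact
      (lsmul_injective_of_isSMulRegular ha) (exact_lsmul_algebraLinearMap hker) hAB).extClass
      (zero_add 1) = x := by
  have hf : (moduleShortComplex (exact_lsmul_algebraLinearMap (B := B) hker)).f =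
      a • 𝟙 (ModuleCat.of A A) := rfl
  have h1 : x.comp (Ext.mk₀ (moduleShortComplex (exact_lsmul_algebraLinearMap (B := B) hker)).f)
      (add_zero 1) = 0 := by
    rw [hf]
    refine (Ext.smul_eq_comp_mk₀ x a).symm.trans ?_
    have : a • 𝟙 (ModuleCat.of A K) = 0 := by
      ext k
      exact smul_eq_zero_of_mem_ker_algebraMap (B := B)
        (hker ▸ Ideal.mem_span_singleton_self a) k
    rw [← Ext.mk₀_id_comp x, ← Ext.smul_comp, ← Ext.mk₀_smul, this, Ext.mk₀_zero, Ext.zero_comp]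
  obtain ⟨y, hy⟩ := Ext.covariant_sequence_exact₁ (ModuleCat.of A K) (moduleShortComplex_shortExact
      (lsmul_injective_of_isSMulRegular ha) (exact_lsmul_algebraLinearMap hker) hAB) x h1
      (zero_add 1)
  obtain ⟨φ, rfl⟩ := Ext.addEquiv₀.symm.surjective y
  exact ⟨φ.hom, hy⟩

/-- The connecting map is also injective: Hom(K, A) = 0, because a kills K and is regular on A. -/
theorem eq_zero_of_comp_extClass_eq_zero {a : A} (hAB : Function.Surjective (algebraMap A B))
    (hker : RingHom.ker (algebraMap A B) = Ideal.span {a}) (ha : IsSMulRegular A a)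
    (φ : K →ₗ[A] B) (hφ : (Ext.mk₀ (ModuleCat.ofHom φ)).comp (moduleShortComplex_shortExact
      (lsmul_injective_of_isSMulRegular ha) (exact_lsmul_algebraLinearMap hker) hAB).extClass
      (zero_add 1) = 0) : φ = 0 := by
  obtain ⟨y, hy⟩ := Ext.covariant_sequence_exact₃ (ModuleCat.of A K) (moduleShortComplex_shortExact
      (lsmul_injective_of_isSMulRegular ha) (exact_lsmul_algebraLinearMap hker) hAB) _
      (zero_add 1) hφ
  obtain ⟨ψ, rfl⟩ := Ext.addEquiv₀.symm.surjective y
  have hψ : ψ = 0 := by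
    ext k
    refine ha ?_
    change a • ψ.hom k = a • (0 : A)
    rw [← map_smul, smul_eq_zero_of_mem_ker_algebraMap (B := B)
      (hker ▸ Ideal.mem_span_singleton_self a) k, map_zero, smul_zero]
  rw [hψ, map_zero, Ext.zero_comp] at hy
  have := (Ext.mk₀_eq_zero_iff _).mp hy.symm
  ext k
  exact congrArg (fun h => h.hom k) this

/-- For 0 → K → B^r → N → 0, the connecting isomorphisms Hom(-, B) ≅ Ext^1(-, A) on K and on B^r
turn Ext^2_A(N, A) into the cokernel of Hom(B^r, B) → Hom(K, B), because Ext^2_A(B^r, A) = 0. -/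
theorem extVanishes_one_iff_two {a : A} (hAB : Function.Surjective (algebraMap A B))
    (hker : RingHom.ker (algebraMap A B) = Ideal.span {a}) (ha : IsSMulRegular A a)
    {N : Type u} [AddCommGroup N] [Module A N] [Module B N] [IsScalarTower A B N] {r : ℕ}
    {π : (Fin r → B) →ₗ[B] N} (hπ : Function.Surjective π) :
    ExtVanishes B N B 1 ↔ ExtVanishes A N A 2 := by
  have hex : Function.Exact ((LinearMap.ker π).subtype.restrictScalars A) (π.restrictScalars A) :=
    LinearMap.exact_subtype_ker_map π
  have hS := moduleShortComplex_shortExact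
    (f := (LinearMap.ker π).subtype.restrictScalars A) (Submodule.subtype_injective _) hex hπ
  have hδ := moduleShortComplex_shortExact
      (lsmul_injective_of_isSMulRegular ha) (exact_lsmul_algebraLinearMap (B := B) hker) hAB
  constructor
  · intro h
    refine subsingleton_of_forall_eq 0 fun η => ?_
    obtain ⟨ζ, rfl⟩ := Ext.contravariant_sequence_exact₃ hS _ η
      (((extVanishes_algebra_self hAB hker ha 0).pi_left r).elim _ _) (add_comm 1 1)
    obtain ⟨φ, rfl⟩ := exists_comp_extClass_eq (B := B) hAB hker ha ζ
    obtain ⟨ψ, hψ⟩ := h.exists_extension (Submodule.subtype_injective _)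
        (LinearMap.exact_subtype_ker_map _) hπ (φ.extendScalarsOfSurjective hAB)
    have : ModuleCat.ofHom φ =
        (moduleShortComplex hex).f ≫ ModuleCat.ofHom (ψ.restrictScalars A) := by
      ext k
      exact (LinearMap.congr_fun hψ k).symm
    rw [this, ← Ext.mk₀_comp_mk₀_assoc]
    exact hS.extClass_comp_assoc _
  · intro h
    refine .one_of_exists_extension (Submodule.subtype_injective _)
        (LinearMap.exact_subtype_ker_map _) hπ fun φ => ?_
    obtain ⟨y, hy⟩ := Ext.contravariant_sequence_exact₁ hS _
      ((Ext.mk₀ (ModuleCat.ofHom (φ.restrictScalars A))).comp hδ.extClass (zero_add 1))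
      (add_comm 1 1) (h.elim _ _)
    obtain ⟨ψ, rfl⟩ := exists_comp_extClass_eq (B := B) (K := Fin r → B) hAB hker ha y
    have h0 : ψ ∘ₗ (LinearMap.ker π).subtype.restrictScalars A - φ.restrictScalars A = 0 := by
      refine eq_zero_of_comp_extClass_eq_zero hAB hker ha _ ?_
      rw [Ext.mk₀_comp_mk₀_assoc] at hy
      have : ModuleCat.ofHom (ψ ∘ₗ (LinearMap.ker π).subtype.restrictScalars A -
          φ.restrictScalars A) = (moduleShortComplex hex).f ≫ ModuleCat.ofHom ψ -
            ModuleCat.ofHom (φ.restrictScalars A) := rfl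
      have hsub : ∀ u v : ModuleCat.of A (LinearMap.ker π) ⟶ ModuleCat.of A B,
          Ext.mk₀ (u - v) = Ext.mk₀ u - Ext.mk₀ v := map_sub Ext.addEquiv₀.symm
      rw [this, hsub, sub_eq_add_neg, Ext.add_comp, Ext.neg_comp, ← sub_eq_add_neg, sub_eq_zero]
      exact hy
    refine ⟨ψ.extendScalarsOfSurjective hAB, ?_⟩
    ext k
    exact LinearMap.congr_fun (sub_eq_zero.mp h0) k

/-- Rees's shift: `Ext^i_B(N, B) = Ext^{i+1}_A(N, A)` for `B = A ⧸ (a)` with `a` regular. -/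
theorem extVanishes_succ_iff_of_regular [IsNoetherianRing B] {a : A}
    (hAB : Function.Surjective (algebraMap A B))
    (hker : RingHom.ker (algebraMap A B) = Ideal.span {a}) (ha : IsSMulRegular A a) (i : ℕ)
    (N : Type u) [AddCommGroup N] [Module A N] [Module B N] [IsScalarTower A B N]
    [Module.Finite B N] : ExtVanishes B N B (i + 1) ↔ ExtVanishes A N A (i + 2) := by
  induction i generalizing N with
  | zero =>
    obtain ⟨r, π, hπ⟩ := Module.Finite.exists_fin' B N
    exact extVanishes_one_iff_two hAB hker ha hπ
  | succ i ih =>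
    obtain ⟨r, π, hπ⟩ := Module.Finite.exists_fin' B N
    have hex : Function.Exact ((LinearMap.ker π).subtype.restrictScalars A)
      (π.restrictScalars A) := LinearMap.exact_subtype_ker_map π
    have hinj : Function.Injective ((LinearMap.ker π).subtype.restrictScalars A) :=
      Submodule.subtype_injective _
    constructor
    · intro h
      exact .of_exact_left_quotient hinj hex hπ ((ih _).mp (h.syzygy
        (Submodule.subtype_injective _) (LinearMap.exact_subtype_ker_map _) hπ))
        ((extVanishes_algebra_self hAB hker ha (i + 1)).pi_left r)
    · intro h
      refine .of_syzygy (Submodule.subtype_injective _) (LinearMap.exact_subtype_ker_map _) hπ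
        ((ih _).mpr ?_)
      exact .of_exact_left_sub hinj hex hπ
        ((extVanishes_algebra_self hAB hker ha i).pi_left r) h

theorem SelfExtBoundedBy.of_regular [IsNoetherianRing B] {a : A}
    (hAB : Function.Surjective (algebraMap A B))
    (hker : RingHom.ker (algebraMap A B) = Ideal.span {a}) (ha : IsSMulRegular A a) {d : ℕ}
    (hA : SelfExtBoundedBy A d) : SelfExtBoundedBy B d := by
  intro N _ _ _ i hi
  obtain ⟨i, rfl⟩ := Nat.exists_eq_succ_of_ne_zero (by omega : i ≠ 0)
  let : Module A N := Module.compHom N (algebraMap A B)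
  have : IsScalarTower A B N := .of_algebraMap_smul fun _ _ => rfl
  have : Module.Finite A B := .of_surjective (Algebra.linearMap A B) hAB
  have : Module.Finite A N := .trans B N
  exact (extVanishes_succ_iff_of_regular hAB hker ha i N).mpr (hA N _ (by omega))

end Rees

/-! ### Ext modulo a regular sequence -/

section RegularSequence

open RingTheory.Sequence Pointwise

variable {A : Type u} [CommRing A] {X N : Type u} [AddCommGroup X] [Module A X] [AddCommGroup N]
  [Module A N]

theorem exact_lsmul_mkQ (a : A) (N : Type*) [AddCommGroup N] [Module A N] :
    Function.Exact (LinearMap.lsmul A N a) (a • (⊤ : Submodule A N)).mkQ := by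
  intro x
  rw [Submodule.mkQ_apply, Submodule.Quotient.mk_eq_zero]
  simp [Submodule.mem_smul_pointwise_iff_exists]

/-- The quotient by the zero ideal. -/
noncomputable def quotOfListNilEquiv (A N : Type*) [CommRing A] [AddCommGroup N] [Module A N] :
    (N ⧸ (Ideal.ofList ([] : List A) • ⊤ : Submodule A N)) ≃ₗ[A] N :=
  Submodule.quotEquivOfEqBot _ (by simp)

theorem ExtVanishes.quot_ofList {n : ℕ} (rs : List A) (hrs : IsWeaklyRegular N rs)
    (h : ∀ i, n < i → ExtVanishes A X N i) :
    ∀ i, n < i → ExtVanishes A X (N ⧸ (Ideal.ofList rs • ⊤ : Submodule A N)) i := by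
  induction rs generalizing N with
  | nil => exact fun i hi => (h i hi).congr_right (quotOfListNilEquiv A N).symm
  | cons a rs ih =>
    rw [isWeaklyRegular_cons_iff] at hrs
    have := ih hrs.2 fun i hi => .of_exact_right_quotient
      (lsmul_injective_of_isSMulRegular hrs.1) (exact_lsmul_mkQ a N) (Submodule.mkQ_surjective _)
      (h i hi) (h _ (by omega))
    exact fun i hi => (this i hi).congr_right
      (Submodule.quotOfListConsSMulTopEquivQuotSMulTopInner N a rs).symm

theorem ExtVanishes.of_quot_ofList [IsLocalRing A] [IsNoetherianRing A] [Module.Finite A X]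
    [Module.Finite A N] (rs : List A) (hm : ∀ a ∈ rs, a ∈ IsLocalRing.maximalIdeal A)
    (hrs : IsWeaklyRegular N rs) {i : ℕ}
    (h : ExtVanishes A X (N ⧸ (Ideal.ofList rs • ⊤ : Submodule A N)) i) :
    ExtVanishes A X N i := by
  induction rs generalizing N with
  | nil => exact h.congr_right (quotOfListNilEquiv A N)
  | cons a rs ih =>
    rw [isWeaklyRegular_cons_iff] at hrs
    exact .of_quotSMulTop (hm a List.mem_cons_self) hrs.1
      (ih (fun b hb => hm b (List.mem_cons_of_mem _ hb)) hrs.2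
        (h.congr_right (Submodule.quotOfListConsSMulTopEquivQuotSMulTopInner N a rs)))

end RegularSequence

/-! ### Powers of an ideal generated by a regular sequence -/

section Powers

open RingTheory.Sequence

variable {A : Type*} [CommRing A]

/-- The family `g` induces a basis of `I ^ j ⧸ I ^ (j + 1)` over `A ⧸ I`. -/
def IsPowerBasis (I : Ideal A) (j : ℕ) {r : ℕ} (g : Fin r → A) : Prop :=
  Ideal.span (Set.range g) = I ^ j ∧
    ∀ c : Fin r → A, ∑ k, c k * g k ∈ I ^ (j + 1) → ∀ k, c k ∈ I

theorem Ideal.sup_span_singleton_pow_succ (I : Ideal A) (x : A) (j : ℕ) :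
    (I ⊔ Ideal.span {x}) ^ (j + 1) =
      I ^ (j + 1) ⊔ Ideal.span {x} * (I ⊔ Ideal.span {x}) ^ j := by
  refine le_antisymm ?_ (sup_le (Ideal.pow_right_mono le_sup_left _) ?_)
  · induction j with
    | zero => simp
    | succ j ih =>
      rw [pow_succ' (I ⊔ Ideal.span {x}) (j + 1), Ideal.sup_mul]
      refine sup_le ((Ideal.mul_mono_right ih).trans ?_) le_sup_right
      rw [Ideal.mul_sup, ← pow_succ']
      refine sup_le_sup_left ?_ _
      rw [mul_left_comm, pow_succ' (I ⊔ Ideal.span {x}) j]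
      exact Ideal.mul_mono_right (Ideal.mul_mono_left le_sup_left)
  · rw [pow_succ']
    exact Ideal.mul_mono_left le_sup_right

/-- An element regular modulo I stays regular modulo each I^j, as the graded pieces are free over
A/I. -/
theorem mul_mem_pow_of_powerBasis {I : Ideal A} (hI : ∀ j, ∃ r, ∃ g : Fin r → A, IsPowerBasis I j g)
    {x : A} (hx : ∀ y, x * y ∈ I → y ∈ I) (j : ℕ) (y : A) (hy : x * y ∈ I ^ j) : y ∈ I ^ j := by
  induction j with
  | zero => simp
  | succ j ih =>
    obtain ⟨r, g, hg, hrel⟩ := hI j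
    have hyj := ih (Ideal.pow_le_pow_right (Nat.le_succ j) hy)
    rw [← hg, Ideal.mem_span_range_iff_exists_fun] at hyj
    obtain ⟨c, rfl⟩ := hyj
    have hc : ∀ k, c k ∈ I := fun k => hx _ <| hrel (fun k => x * c k)
      (by simpa only [Finset.mul_sum, mul_assoc] using hy) k
    rw [pow_succ']
    refine Ideal.sum_mem _ fun k _ => Ideal.mul_mem_mul (hc k) ?_
    rw [← hg]
    exact Ideal.subset_span ⟨k, rfl⟩

/-- Degree j + 1 monomials either avoid x (the family g) or are x times one of degree j (the family
h). For independence, write a + x b = u + x w with u in I^(j+2) and w in (I + (x))^(j+1). Regularity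
of x modulo I^(j+1) puts w - b in I^(j+1). This controls b, hence the coefficients of h, and
expanding w - b in g controls those of g modulo x. -/
theorem IsPowerBasis.append {I : Ideal A} (hI : ∀ j, ∃ r, ∃ g : Fin r → A, IsPowerBasis I j g)
    {x : A} (hx : ∀ y, x * y ∈ I → y ∈ I) {j r s : ℕ} {g : Fin r → A} {h : Fin s → A}
    (hg : IsPowerBasis I (j + 1) g) (hh : IsPowerBasis (I ⊔ Ideal.span {x}) j h) :
    IsPowerBasis (I ⊔ Ideal.span {x}) (j + 1) (Fin.append g fun k => x * h k) := by
  have hle : I ≤ I ⊔ Ideal.span {x} := le_sup_left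
  have hxmem : x ∈ I ⊔ Ideal.span {x} :=
    le_sup_right (a := I) (Ideal.mem_span_singleton_self x)
  constructor
  · rw [Ideal.sup_span_singleton_pow_succ, ← hg.1, ← hh.1, Ideal.span_mul_span', ← Ideal.span_union]
    congr 1
    ext y
    simp only [Set.mem_range, Set.singleton_mul, Set.mem_union, Set.mem_image,
      exists_exists_eq_and]
    constructor
    · rintro ⟨k, rfl⟩
      refine Fin.addCases (fun k => ?_) (fun k => ?_) k
      · exact Or.inl ⟨k, by simp⟩
      · exact Or.inr ⟨k, by simp⟩
    · rintro (⟨k, rfl⟩ | ⟨k, rfl⟩)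
      · exact ⟨Fin.castAdd s k, by simp⟩
      · exact ⟨Fin.natAdd r k, by simp⟩
  · intro c hc
    rw [Fin.sum_univ_add, Ideal.sup_span_singleton_pow_succ] at hc
    simp only [Fin.append_left, Fin.append_right] at hc
    obtain ⟨u, hu, w', hw', huw⟩ := Submodule.mem_sup.mp hc
    obtain ⟨w, hw, rfl⟩ := Ideal.mem_span_singleton_mul.mp hw'
    set a := ∑ k, c (Fin.castAdd s k) * g k with ha
    set b := ∑ k, c (Fin.natAdd r k) * h k with hb
    have hxb : ∑ k, c (Fin.natAdd r k) * (x * h k) = x * b := by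
      rw [hb, Finset.mul_sum]
      exact Finset.sum_congr rfl fun k _ => mul_left_comm _ _ _
    rw [hxb] at huw
    have hamem : a ∈ I ^ (j + 1) := by
      rw [← hg.1, Ideal.mem_span_range_iff_exists_fun]
      exact ⟨_, rfl⟩
    have hwb : w - b ∈ I ^ (j + 1) := by
      refine mul_mem_pow_of_powerBasis hI hx _ _ ?_
      rw [show x * (w - b) = a - u by linear_combination huw]
      exact sub_mem hamem (Ideal.pow_le_pow_right (by omega) hu)
    have hbmem : b ∈ (I ⊔ Ideal.span {x}) ^ (j + 1) := by
      simpa using sub_mem hw (Ideal.pow_right_mono hle _ hwb)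
    have hwb' := hwb
    rw [← hg.1, Ideal.mem_span_range_iff_exists_fun] at hwb'
    obtain ⟨e, he⟩ := hwb'
    have hrel := hg.2 (fun k => c (Fin.castAdd s k) - x * e k) (by
      have : ∑ k, (c (Fin.castAdd s k) - x * e k) * g k = u := by
        simp only [sub_mul, Finset.sum_sub_distrib, mul_assoc, ← Finset.mul_sum, he]
        linear_combination -huw
      rw [this]
      exact hu)
    intro k
    refine Fin.addCases (fun k => ?_) (fun k => ?_) k
    · have := add_mem (hle (hrel k)) (Ideal.mul_mem_right (e k) _ hxmem)
      simpa using this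
    · exact hh.2 _ hbmem k

theorem isPowerBasis_zero (I : Ideal A) : ∃ g : Fin 1 → A, IsPowerBasis I 0 g := by
  refine ⟨fun _ => 1, ?_, fun c hc k => ?_⟩
  · rw [pow_zero, Ideal.one_eq_top, Ideal.eq_top_iff_one]
    exact Ideal.subset_span ⟨0, rfl⟩
  · rw [Subsingleton.elim k 0]
    simpa using hc

/-- A weakly regular sequence is quasi-regular: the powers of its ideal have free quotients. -/
theorem exists_isPowerBasis (rs : List A) (hrs : IsWeaklyRegular A rs) (j : ℕ) :
    ∃ g : Fin (Nat.multichoose rs.length j) → A, IsPowerBasis (Ideal.ofList rs) j g := by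
  induction rs using List.reverseRecOn generalizing j with
  | nil =>
    rw [List.length_nil, Ideal.ofList_nil]
    cases j with
    | zero =>
      rw [Nat.multichoose_zero_right]
      exact isPowerBasis_zero _
    | succ j =>
      rw [Nat.multichoose_zero_succ]
      refine ⟨fun _ => 0, ?_, fun _ _ k => k.elim0⟩
      rw [pow_succ, Ideal.mul_bot, Set.range_eq_empty, Ideal.span_empty]
  | append_singleton rs x ih =>
    rw [isWeaklyRegular_append_iff, isWeaklyRegular_singleton_iff] at hrs
    have hx : ∀ y, x * y ∈ Ideal.ofList rs → y ∈ Ideal.ofList rs := by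
      intro y hy
      have h := hrs.2
      rw [isSMulRegular_on_quot_iff_lsmul_comap_le] at h
      simpa using @h y (by simpa using hy)
    rw [Ideal.ofList_append, Ideal.ofList_singleton, List.length_append, List.length_singleton]
    induction j with
    | zero =>
      rw [Nat.multichoose_zero_right]
      exact isPowerBasis_zero _
    | succ j ihj =>
      obtain ⟨h, hh⟩ := ihj
      obtain ⟨g, hg⟩ := ih hrs.1 (j + 1)
      -- Pascal's rule counts monomials without and with the new element.
      rw [Nat.multichoose_succ_succ]
      exact ⟨_, IsPowerBasis.append (fun j => ⟨_, ih hrs.1 j⟩) hx hg hh⟩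

variable {M : Type*} [AddCommGroup M] [Module A M]

theorem Ideal.mem_span_range_smul_iff {r : ℕ} {g : Fin r → A} {N : Submodule A M} {m : M} :
    m ∈ Ideal.span (Set.range g) • N ↔ ∃ n : Fin r → M, (∀ k, n k ∈ N) ∧ ∑ k, g k • n k = m := by
  constructor
  · intro hm
    induction hm using Submodule.smul_induction_on' with
    | smul a ha m hm =>
      obtain ⟨c, rfl⟩ := Ideal.mem_span_range_iff_exists_fun.mp ha
      refine ⟨fun k => c k • m, fun k => N.smul_mem _ hm, ?_⟩
      rw [Finset.sum_smul]
      exact Finset.sum_congr rfl fun k _ => by rw [smul_smul, mul_comm]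
    | add x _ y _ hx hy =>
      obtain ⟨m, hm, rfl⟩ := hx
      obtain ⟨n, hn, rfl⟩ := hy
      exact ⟨m + n, fun k => N.add_mem (hm k) (hn k), by
        simp only [Pi.add_apply, smul_add, Finset.sum_add_distrib]⟩
  · rintro ⟨n, hn, rfl⟩
    exact Submodule.sum_mem _ fun k _ =>
      Submodule.smul_mem_smul (Ideal.subset_span ⟨k, rfl⟩) (hn k)

/-- The quotients `I ^ j • M ⧸ I ^ (j + 1) • M` for `j < ℓ` are copies of `M ⧸ I • M`, via the
power bases of `I`. -/
def HasFreePowers (I : Ideal A) (ℓ : ℕ) (M : Type*) [AddCommGroup M] [Module A M] : Prop :=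
  ∀ j < ℓ, ∀ (r : ℕ) (g : Fin r → A), IsPowerBasis I j g → ∀ m : Fin r → M,
    ∑ k, g k • m k ∈ I ^ (j + 1) • (⊤ : Submodule A M) → ∀ k, m k ∈ I • (⊤ : Submodule A M)

theorem hasFreePowers_pi (I : Ideal A) (ℓ s : ℕ) : HasFreePowers I ℓ (Fin s → A) := by
  intro j _ r g hg m hm k
  rw [mem_ideal_smul_top_pi] at hm ⊢
  intro i
  refine hg.2 (fun k => m k i) ?_ k
  simpa [mul_comm] using hm i

theorem hasFreePowers_self (I : Ideal A) (ℓ : ℕ) : HasFreePowers I ℓ A := by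
  intro j _ r g hg m hm k
  simp only [smul_eq_mul, Ideal.mul_top] at hm ⊢
  exact hg.2 m (by simpa only [mul_comm] using hm) k

variable {I : Ideal A} {ℓ s : ℕ} {π : (Fin s → A) →ₗ[A] M}

/-- Write an element as a combination of the basis of I^j with coefficients in ker π. If it lies in
I^(j+1) • A^s, freeness puts the coefficients in I • A^s, and the case j = 1 puts them in I • ker π.
-/
theorem ker_inf_pow_smul_le (hI : ∀ j < ℓ, ∃ r, ∃ g : Fin r → A, IsPowerBasis I j g)
    (htor : LinearMap.ker π ⊓ I • ⊤ ≤ I • LinearMap.ker π) (j : ℕ) (hj : j ≤ ℓ) :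
    LinearMap.ker π ⊓ I ^ j • ⊤ ≤ I ^ j • LinearMap.ker π := by
  induction j with
  | zero => simp
  | succ j ih =>
    rintro v ⟨hv, hvI⟩
    have hvj := ih (by omega) ⟨hv, Submodule.smul_mono_left
      (Ideal.pow_le_pow_right (Nat.le_succ j)) hvI⟩
    obtain ⟨r, g, hg⟩ := hI j (by omega)
    rw [← hg.1, Ideal.mem_span_range_smul_iff] at hvj
    obtain ⟨n, hn, rfl⟩ := hvj
    have hnI := hasFreePowers_pi I ℓ s j (by omega) r g hg n hvI
    rw [pow_succ, Submodule.mul_smul, ← hg.1]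
    exact Ideal.mem_span_range_smul_iff.mpr ⟨n, fun k => htor ⟨hn k, hnI k⟩, rfl⟩

/-- A relation in M lifts to the free module up to an element of ker π ∩ I^j • A^s = I^j • ker π,
which can be absorbed into the coefficients. -/
theorem HasFreePowers.of_surjective (hI : ∀ j < ℓ, ∃ r, ∃ g : Fin r → A, IsPowerBasis I j g)
    (hπ : Function.Surjective π) (htor : LinearMap.ker π ⊓ I • ⊤ ≤ I • LinearMap.ker π) :
    HasFreePowers I ℓ M := by
  intro j hj r g hg m hm k
  choose v hv using fun k => hπ (m k)
  have hmap : ∀ i, (I ^ i • (⊤ : Submodule A M)) = (I ^ i • ⊤ : Submodule A _).map π := by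
    intro i
    rw [Submodule.map_smul'', ← LinearMap.range_eq_map, LinearMap.range_eq_top.mpr hπ]
  have hsum : ∑ k, g k • m k = π (∑ k, g k • v k) := by simp [hv]
  rw [hsum, hmap] at hm
  obtain ⟨u, hu, huv⟩ := hm
  have hker : ∑ k, g k • v k - u ∈ LinearMap.ker π ⊓ I ^ j • ⊤ := by
    refine ⟨LinearMap.mem_ker.mpr (by rw [map_sub, huv, sub_self]), sub_mem ?_ ?_⟩
    · rw [← hg.1]
      exact Ideal.mem_span_range_smul_iff.mpr ⟨v, fun _ => trivial, rfl⟩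
    · exact Submodule.smul_mono_left (Ideal.pow_le_pow_right (Nat.le_succ j)) hu
  have := ker_inf_pow_smul_le hI htor j hj.le hker
  rw [← hg.1, Ideal.mem_span_range_smul_iff] at this
  obtain ⟨n, hn, hnv⟩ := this
  have hvn := hasFreePowers_pi I ℓ s j hj r g hg (v - n) (by
    have : ∑ k, g k • (v - n) k = u := by
      simp only [Pi.sub_apply, smul_sub, Finset.sum_sub_distrib, hnv, sub_sub_cancel]
    rwa [this]) k
  have hvn' : π ((v - n) k) ∈ (I • ⊤ : Submodule A _).map π := Submodule.mem_map_of_mem hvn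
  rw [← pow_one I, ← hmap, pow_one, Pi.sub_apply, map_sub, hv, LinearMap.mem_ker.mp (hn k),
    sub_zero] at hvn'
  exact hvn'

theorem Ideal.pow_succ_smul_top_le (I : Ideal A) (M : Type*) [AddCommGroup M] [Module A M]
    (j : ℕ) : (I ^ (j + 1) • ⊤ : Submodule A M) ≤ I ^ j • ⊤ :=
  Submodule.smul_mono_left (Ideal.pow_le_pow_right (Nat.le_succ j))

/-- The map is (m_k) ↦ ∑ g_k m_k, with image I^j M / I^(j+1) M; freeness makes it injective. -/
theorem HasFreePowers.exists_exact (hM : HasFreePowers I ℓ M) {j r : ℕ} (hj : j < ℓ)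
    {g : Fin r → A} (hg : IsPowerBasis I j g) :
    ∃ f : (Fin r → M ⧸ (I • ⊤ : Submodule A M)) →ₗ[A] M ⧸ (I ^ (j + 1) • ⊤ : Submodule A M),
      Function.Injective f ∧
        Function.Exact f (Submodule.factor (Ideal.pow_succ_smul_top_le I M j)) := by
  let φ : (Fin r → M) →ₗ[A] M ⧸ (I ^ (j + 1) • ⊤ : Submodule A M) :=
    Submodule.mkQ _ ∘ₗ ∑ k, g k • LinearMap.proj k
  let q : (Fin r → M) →ₗ[A] (Fin r → M ⧸ (I • ⊤ : Submodule A M)) :=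
    (Submodule.mkQ _).compLeft (Fin r)
  have hφ : ∀ m, φ m = Submodule.mkQ _ (∑ k, g k • m k) := fun m => by simp [φ]
  have hq : Function.Surjective q := fun w =>
    ⟨fun k => (Submodule.mkQ_surjective _ (w k)).choose,
      funext fun k => (Submodule.mkQ_surjective _ (w k)).choose_spec⟩
  have hqmem : ∀ m, q m = 0 ↔ ∀ k, m k ∈ (I • ⊤ : Submodule A M) := fun m => by
    simp [q, funext_iff]
  have hφmem : ∀ m, φ m = 0 ↔ ∑ k, g k • m k ∈ (I ^ (j + 1) • ⊤ : Submodule A M) := fun m => by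
    rw [hφ, Submodule.mkQ_apply, Submodule.Quotient.mk_eq_zero]
  have hker : LinearMap.ker q ≤ LinearMap.ker φ := by
    intro m hm
    rw [LinearMap.mem_ker, hφmem, pow_succ, Submodule.mul_smul, ← hg.1]
    exact Ideal.mem_span_range_smul_iff.mpr ⟨m, (hqmem m).mp hm, rfl⟩
  obtain ⟨f, hf⟩ := LinearMap.exists_comp_eq_of_ker_le hq hker
  have hf' : ∀ m, f (q m) = φ m := LinearMap.congr_fun hf
  refine ⟨f, ?_, ?_⟩
  · rw [← LinearMap.ker_eq_bot, LinearMap.ker_eq_bot']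
    intro w hw
    obtain ⟨m, rfl⟩ := hq w
    rw [hf', hφmem] at hw
    exact (hqmem m).mpr (hM j hj r g hg m hw)
  · intro y
    obtain ⟨y, rfl⟩ := Submodule.mkQ_surjective _ y
    rw [Submodule.mkQ_apply]
    refine Iff.trans (Submodule.Quotient.mk_eq_zero _) ?_
    constructor
    · intro hy
      rw [← hg.1, Ideal.mem_span_range_smul_iff] at hy
      obtain ⟨m, -, rfl⟩ := hy
      exact ⟨q m, by rw [hf', hφ]; rfl⟩
    · rintro ⟨w, hw⟩
      obtain ⟨m, rfl⟩ := hq w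
      rw [hf', hφ, Submodule.mkQ_apply, Submodule.Quotient.eq] at hw
      have h1 := Ideal.pow_succ_smul_top_le I M j hw
      have h2 : ∑ k, g k • m k ∈ (I ^ j • ⊤ : Submodule A M) := by
        rw [← hg.1]
        exact Ideal.mem_span_range_smul_iff.mpr ⟨m, fun _ => trivial, rfl⟩
      simpa using sub_mem h2 h1

end Powers

/-! ### Lengths of localizations -/

section LocalLength

/-- The length of the localization of a module at a prime. -/
noncomputable def localLength {A : Type*} [CommRing A] (p : Ideal A) [p.IsPrime] (E : Type*)
    [AddCommGroup E] [Module A E] : ℕ∞ :=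
  Module.length (Localization.AtPrime p) (LocalizedModule p.primeCompl E)

variable {A : Type*} [CommRing A] (p : Ideal A) [p.IsPrime]
variable {E E₁ E₂ E₃ : Type*} [AddCommGroup E] [Module A E] [AddCommGroup E₁] [Module A E₁]
  [AddCommGroup E₂] [Module A E₂] [AddCommGroup E₃] [Module A E₃]

theorem Module.length_le_add_of_exact {f : E₁ →ₗ[A] E₂} {g : E₂ →ₗ[A] E₃}
    (hfg : Function.Exact f g) :
    Module.length A E₂ ≤ Module.length A E₁ + Module.length A E₃ := by
  rw [Module.length_eq_add_of_exact (LinearMap.range f).subtype (LinearMap.range f).mkQ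
    (Submodule.subtype_injective _) (Submodule.mkQ_surjective _)
    (LinearMap.exact_subtype_mkQ _)]
  refine add_le_add (Module.length_le_of_surjective f.rangeRestrict f.surjective_rangeRestrict) ?_
  have hle : LinearMap.range f ≤ LinearMap.ker g := (LinearMap.exact_iff.mp hfg).ge
  refine Module.length_le_of_injective ((LinearMap.range f).liftQ g hle) ?_
  rw [← LinearMap.ker_eq_bot, Submodule.ker_liftQ_eq_bot _ _ _ (LinearMap.exact_iff.mp hfg).le]

theorem localLength_le_add_of_exact {f : E₁ →ₗ[A] E₂} {g : E₂ →ₗ[A] E₃}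
    (hfg : Function.Exact f g) :
    localLength p E₂ ≤ localLength p E₁ + localLength p E₃ :=
  Module.length_le_add_of_exact (f := LocalizedModule.map p.primeCompl f)
    (g := LocalizedModule.map p.primeCompl g) (LocalizedModule.map_exact p.primeCompl f g hfg)

theorem localLength_eq_add_of_exact {f : E₁ →ₗ[A] E₂} {g : E₂ →ₗ[A] E₃}
    (hf : Function.Injective f) (hfg : Function.Exact f g) (hg : Function.Surjective g) :
    localLength p E₂ = localLength p E₁ + localLength p E₃ :=
  Module.length_eq_add_of_exact (LocalizedModule.map p.primeCompl f)
    (LocalizedModule.map p.primeCompl g) (LocalizedModule.map_injective p.primeCompl f hf)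
    (LocalizedModule.map_surjective p.primeCompl g hg)
    (LocalizedModule.map_exact p.primeCompl f g hfg)

theorem localLength_of_subsingleton [Subsingleton E] : localLength p E = 0 :=
  Module.length_eq_zero_iff.mpr inferInstance

theorem localLength_eq_zero_iff : localLength p E = 0 ↔ ⟨p, ‹_›⟩ ∉ Module.support A E := by
  rw [Module.notMem_support_iff]
  exact Module.length_eq_zero_iff

/-- At a minimal prime of the annihilator, the localized module is finite over an Artinian quotient.
-/
theorem localLength_ne_top [IsNoetherianRing A] [Module.Finite A E]
    (hp : p ∈ (Module.annihilator A E).minimalPrimes) : localLength p E ≠ ⊤ := by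
  let J := (Module.annihilator A E).map (algebraMap A (Localization.AtPrime p))
  have hJ : IsLocalRing.maximalIdeal (Localization.AtPrime p) ∈ J.minimalPrimes := by
    rw [IsLocalization.minimalPrimes_map p.primeCompl, Set.mem_preimage,
      Localization.AtPrime.under_maximalIdeal]
    exact hp
  have := IsLocalRing.quotient_artinian_of_mem_minimalPrimes_of_isLocalRing J hJ
  have hann : J ≤ Module.annihilator (Localization.AtPrime p) (LocalizedModule p.primeCompl E) := by
    refine Ideal.map_le_iff_le_comap.mpr fun a ha => ?_
    rw [Ideal.mem_comap, Module.mem_annihilator]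
    intro z
    induction z using LocalizedModule.induction_on with
    | _ m s =>
      rw [algebraMap_smul, LocalizedModule.smul'_mk, Module.mem_annihilator.mp ha,
        LocalizedModule.zero_mk]
  have htors : Module.IsTorsionBySet (Localization.AtPrime p)
      (LocalizedModule p.primeCompl E) J := fun z a => Module.mem_annihilator.mp (hann a.2) z
  let := htors.module
  have := htors.isScalarTower (S := Localization.AtPrime p)
  have : Module.Finite (Localization.AtPrime p ⧸ J) (LocalizedModule p.primeCompl E) :=
    .of_restrictScalars_finite (Localization.AtPrime p) _ _
  rw [localLength, Module.length_eq_of_surjective (R := Localization.AtPrime p ⧸ J)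
    Ideal.Quotient.mk_surjective]
  exact Module.length_ne_top

/-- Supports shrink, so the radicals of the annihilators stabilize. At a minimal prime of a proper
stable value the local lengths would be finite, nonzero and strictly decreasing forever. -/
theorem exists_subsingleton_of_localLength_le [IsNoetherianRing A] {E : ℕ → Type*}
    [∀ i, AddCommGroup (E i)] [∀ i, Module A (E i)] [∀ i, Module.Finite A (E i)] {s t : ℕ}
    (hst : s < t) (h : ∀ (p : Ideal A) [p.IsPrime] (i : ℕ),
      t * localLength p (E (i + 1)) ≤ s * localLength p (E i)) :
    ∃ n, ∀ i, n ≤ i → Subsingleton (E i) := by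
  have hsupp : ∀ i, Module.support A (E (i + 1)) ⊆ Module.support A (E i) := by
    intro i q hq
    by_contra hq'
    have h0 := (localLength_eq_zero_iff q.asIdeal).mpr hq'
    have h1 := h q.asIdeal i
    rw [h0, mul_zero, nonpos_iff_eq_zero, mul_eq_zero] at h1
    rcases h1 with h1 | h1
    · simp only [Nat.cast_eq_zero] at h1
      omega
    · exact (localLength_eq_zero_iff q.asIdeal).mp h1 hq
  let a : ℕ →o Ideal A := ⟨fun i => (Module.annihilator A (E i)).radical, monotone_nat_of_le_succ
    fun i => by
      have := hsupp i
      rwa [Module.support_eq_zeroLocus, Module.support_eq_zeroLocus,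
        PrimeSpectrum.zeroLocus_subset_zeroLocus_iff, ← Ideal.radical_le_radical_iff] at this⟩
  obtain ⟨n, hn⟩ := monotone_stabilizes_iff_noetherian.mpr ‹IsNoetherianRing A› a
  refine ⟨n, fun i hi => ?_⟩
  by_contra hne
  have hproper : a n ≠ ⊤ := by
    rw [hn i hi]
    intro htop
    refine hne ?_
    rw [← Module.annihilator_eq_top_iff (R := A)]
    exact Ideal.radical_eq_top.mp htop
  obtain ⟨p, hp⟩ := Ideal.nonempty_minimalPrimes hproper
  have := hp.1.1
  have hmin : ∀ m, n ≤ m → p ∈ (Module.annihilator A (E m)).minimalPrimes := by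
    intro m hm
    rw [← Ideal.radical_minimalPrimes]
    have : a n = a m := hn m hm
    rw [this] at hp
    exact hp
  have hpos : ∀ m, n ≤ m → localLength p (E m) ≠ 0 := by
    intro m hm h0
    rw [localLength_eq_zero_iff, Module.support_eq_zeroLocus] at h0
    exact h0 (hmin m hm).1.2
  have hnat : ∀ k, ∃ e : ℕ, (e : ℕ∞) = localLength p (E (n + k)) := fun k =>
    ENat.ne_top_iff_exists.mp (localLength_ne_top p (hmin _ (by omega)))
  choose e he using hnat
  have hlt : ∀ k, e (k + 1) < e k := by
    intro k
    have h1 := h p (n + k)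
    rw [add_assoc, ← he, ← he] at h1
    have h2 : t * e (k + 1) ≤ s * e k := by exact_mod_cast h1
    have h3 : e (k + 1) ≠ 0 := by
      intro h0
      apply hpos (n + (k + 1)) (by omega)
      rw [← he, h0, Nat.cast_zero]
    by_contra! h4
    have h5 : s * e k ≤ s * e (k + 1) := Nat.mul_le_mul_left s h4
    have h6 : s * e (k + 1) < t * e (k + 1) := Nat.mul_lt_mul_of_pos_right hst (by omega)
    omega
  have hdesc : ∀ k, e k + k ≤ e 0 := by
    intro k
    induction k with
    | zero => simp
    | succ k ih => have := hlt k; omega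
  have := hdesc (e 0 + 1)
  omega

end LocalLength

/-! ### Ext into iterated extensions -/

section ExtLength

open Abelian

variable {A : Type u} [CommRing A] {X : Type u} [AddCommGroup X] [Module A X]
variable {M₁ : Type u} [AddCommGroup M₁] [Module A M₁]
variable {M₂ : Type u} [AddCommGroup M₂] [Module A M₂]
variable {M₃ : Type u} [AddCommGroup M₃] [Module A M₃]
variable {f : M₁ →ₗ[A] M₂} {g : M₂ →ₗ[A] M₃}

/-- The local length of `Ext^i(X, M)` at a prime. -/
noncomputable def extLength (p : Ideal A) [p.IsPrime] (X M : Type u) [AddCommGroup X] [Module A X]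
    [AddCommGroup M] [Module A M] (i : ℕ) : ℕ∞ :=
  localLength p (Abelian.Ext (ModuleCat.of A X) (ModuleCat.of A M) i)

theorem extLength_le_add_of_exact (p : Ideal A) [p.IsPrime] (hf : Function.Injective f)
    (hfg : Function.Exact f g) (hg : Function.Surjective g) (i : ℕ) :
    extLength p X M₂ i ≤ extLength p X M₁ i + extLength p X M₃ i := by
  have hS := moduleShortComplex_shortExact hf hfg hg
  refine localLength_le_add_of_exact p
    (f := (Ext.mk₀ (moduleShortComplex hfg).f).postcompOfLinear A (ModuleCat.of A X) (add_zero i))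
    (g := (Ext.mk₀ (moduleShortComplex hfg).g).postcompOfLinear A (ModuleCat.of A X) (add_zero i)) ?_
  exact (ShortComplex.ab_exact_iff_function_exact _).mp
    (Ext.covariant_sequence_exact₂' (ModuleCat.of A X) hS i)

theorem extLength_succ_le_add_of_exact (p : Ideal A) [p.IsPrime] (hf : Function.Injective f)
    (hfg : Function.Exact f g) (hg : Function.Surjective g) (i : ℕ) :
    extLength p X M₁ (i + 1) ≤ extLength p X M₃ i + extLength p X M₂ (i + 1) := by
  have hS := moduleShortComplex_shortExact hf hfg hg
  refine localLength_le_add_of_exact p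
    (f := hS.extClass.postcompOfLinear A (ModuleCat.of A X) rfl)
    (g := (Ext.mk₀ (moduleShortComplex hfg).f).postcompOfLinear A (ModuleCat.of A X)
      (add_zero (i + 1))) ?_
  exact (ShortComplex.ab_exact_iff_function_exact _).mp
    (Ext.covariant_sequence_exact₁' (ModuleCat.of A X) hS i (i + 1) rfl)

theorem extLength_pi_succ (p : Ideal A) [p.IsPrime] (N : Type u) [AddCommGroup N] [Module A N]
    (r i : ℕ) :
    extLength p X (Fin (r + 1) → N) i = extLength p X N i + extLength p X (Fin r → N) i := by
  have hS := moduleShortComplex_shortExact (single_injective A N r) (exact_single_zero_tail A N r)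
      (funLeft_succ_surjective A N r)
  let S := moduleShortComplex (exact_single_zero_tail A N r)
  let ρ : S.X₂ ⟶ S.X₁ := ModuleCat.ofHom (LinearMap.proj 0)
  let σ : S.X₃ ⟶ S.X₂ := ModuleCat.ofHom (LinearMap.pi (Fin.cons 0 fun k => LinearMap.proj k))
  have hρ : S.f ≫ ρ = 𝟙 _ := by
    ext x
    exact Pi.single_eq_same (M := fun _ : Fin (r + 1) => N) 0 x
  have hσ : σ ≫ S.g = 𝟙 _ := by
    ext x
    rfl
  refine localLength_eq_add_of_exact p
    (f := (Ext.mk₀ S.f).postcompOfLinear A (ModuleCat.of A X) (add_zero i))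
    (g := (Ext.mk₀ S.g).postcompOfLinear A (ModuleCat.of A X) (add_zero i)) ?_ ?_ ?_
  · refine Function.LeftInverse.injective
      (g := fun x => x.comp (Ext.mk₀ ρ) (add_zero i)) fun x => ?_
    change (x.comp (Ext.mk₀ S.f) (add_zero i)).comp (Ext.mk₀ ρ) (add_zero i) = x
    rw [Ext.comp_assoc_of_third_deg_zero, Ext.mk₀_comp_mk₀, hρ, Ext.comp_mk₀_id]
  · exact (ShortComplex.ab_exact_iff_function_exact _).mp
      (Ext.covariant_sequence_exact₂' (ModuleCat.of A X) hS i)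
  · refine Function.RightInverse.surjective
      (g := fun x => x.comp (Ext.mk₀ σ) (add_zero i)) fun x => ?_
    change (x.comp (Ext.mk₀ σ) (add_zero i)).comp (Ext.mk₀ S.g) (add_zero i) = x
    rw [Ext.comp_assoc_of_third_deg_zero, Ext.mk₀_comp_mk₀, hσ, Ext.comp_mk₀_id]

theorem extLength_eq_zero (p : Ideal A) [p.IsPrime] {i : ℕ} (h : ExtVanishes A X M₁ i) :
    extLength p X M₁ i = 0 :=
  have : Subsingleton (Abelian.Ext (ModuleCat.of A X) (ModuleCat.of A M₁) i) := h
  localLength_of_subsingleton p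

theorem extLength_pi (p : Ideal A) [p.IsPrime] (N : Type u) [AddCommGroup N] [Module A N]
    (r i : ℕ) : extLength p X (Fin r → N) i = r * extLength p X N i := by
  induction r with
  | zero => rw [extLength_eq_zero p .of_subsingleton_right, Nat.cast_zero, zero_mul]
  | succ r ih => rw [extLength_pi_succ, ih, Nat.cast_succ, add_mul, one_mul, add_comm]

variable {N : Type u} [AddCommGroup N] [Module A N]
variable {L : ℕ → Type u} [∀ j, AddCommGroup (L j)] [∀ j, Module A (L j)]

/-- The modules `L 0 = 0, L 1, …, L ℓ` are successive extensions by powers `N ^ ρ j`. -/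
structure IsIteratedExtension (A : Type u) [CommRing A] (N : Type u) [AddCommGroup N] [Module A N]
    (L : ℕ → Type u) [∀ j, AddCommGroup (L j)] [∀ j, Module A (L j)] (ρ : ℕ → ℕ) (ℓ : ℕ) :
    Prop where
  subsingleton : Subsingleton (L 0)
  exists_exact : ∀ j < ℓ, ∃ (f : (Fin (ρ j) → N) →ₗ[A] L (j + 1)) (g : L (j + 1) →ₗ[A] L j),
    Function.Injective f ∧ Function.Exact f g ∧ Function.Surjective g

variable {ρ : ℕ → ℕ} {ℓ : ℕ}

theorem IsIteratedExtension.extVanishes (hL : IsIteratedExtension A N L ρ ℓ) {i : ℕ}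
    (h : ExtVanishes A X N i) (j : ℕ) (hj : j ≤ ℓ) : ExtVanishes A X (L j) i := by
  induction j with
  | zero =>
    have := hL.subsingleton
    exact .of_subsingleton_right
  | succ j ih =>
    obtain ⟨f, g, hf, hfg, hg⟩ := hL.exists_exact j hj
    exact .of_exact_right hf hfg hg (h.pi_right _) (ih (by omega))

theorem IsIteratedExtension.extLength_le (hL : IsIteratedExtension A N L ρ ℓ) (p : Ideal A)
    [p.IsPrime] (i j : ℕ) (hj : j ≤ ℓ) :
    extLength p X (L j) i ≤ (∑ k ∈ Finset.range j, ρ k : ℕ) * extLength p X N i := by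
  induction j with
  | zero =>
    have := hL.subsingleton
    rw [extLength_eq_zero p .of_subsingleton_right]
    exact zero_le
  | succ j ih =>
    obtain ⟨f, g, hf, hfg, hg⟩ := hL.exists_exact j hj
    refine (extLength_le_add_of_exact p hf hfg hg i).trans ?_
    rw [extLength_pi, Finset.sum_range_succ, Nat.cast_add, add_mul, add_comm]
    exact add_le_add_left (ih (by omega)) _

/-- If `Ext(X, N)` vanishes in high degrees and `Ext(X, L ℓ)` in degrees above `n`, then `Ext(X, N)`
vanishes in degrees above `n`. -/
theorem IsIteratedExtension.extVanishes_of_eventually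
    (hL : IsIteratedExtension A N L ρ (ℓ + 1)) (hρ : ρ 0 = 1) {n : ℕ}
    (hℓ : ∀ i, n < i → ExtVanishes A X (L (ℓ + 1)) i)
    {m : ℕ} (hm : ∀ i, m < i → ExtVanishes A X N i) : ∀ i, n < i → ExtVanishes A X N i := by
  obtain hnm | hnm := le_or_gt m n
  · exact fun i hi => hm i (by omega)
  obtain ⟨k, rfl⟩ := Nat.exists_eq_add_of_le hnm.le
  clear hnm
  induction k with
  | zero => exact hm
  | succ k ih =>
    refine ih fun i hi => ?_
    obtain hi' | rfl := Nat.lt_or_eq_of_le (Nat.succ_le_of_lt hi)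
    · exact hm i (by omega)
    -- The next degree of Ext(X, N) is already zero, so vanishing passes from each L (j + 1) to its
    -- quotient L j, down to L 1 ≅ N.
    have hdown : ∀ j, j ≤ ℓ → ExtVanishes A X (L (ℓ + 1 - j)) (n + k + 1) := by
      intro j hj
      induction j with
      | zero => exact hℓ _ (by omega)
      | succ j ihj =>
        obtain ⟨f, g, hf, hfg, hg⟩ := hL.exists_exact (ℓ + 1 - (j + 1)) (by omega)
        have h1 := ihj (by omega)
        rw [show ℓ + 1 - j = ℓ + 1 - (j + 1) + 1 by omega] at h1
        exact .of_exact_right_quotient hf hfg hg h1 ((hm _ (by omega)).pi_right _)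
    have h1 := hdown ℓ le_rfl
    obtain ⟨f, g, hf, hfg, hg⟩ := hL.exists_exact 0 (by omega)
    rw [show ℓ + 1 - ℓ = 0 + 1 by omega] at h1
    have := hL.subsingleton
    have hfs : Function.Surjective f := fun y => (hfg y).mp (Subsingleton.elim _ _)
    have h2 := h1.congr_right (LinearEquiv.ofBijective f ⟨hf, hfs⟩).symm
    rw [hρ] at h2
    exact h2.congr_right (LinearEquiv.funUnique (Fin 1) A N)

/-- The kernel of L (ℓ + 1) → L ℓ is N^(ρ ℓ). Above degree n, ρ ℓ times the length of Ext^(i+1)(X,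
N) is therefore at most the length of Ext^i(X, L ℓ), itself at most ∑ ρ k times that of Ext^i(X, N).
The strict inequality forces eventual vanishing. -/
theorem IsIteratedExtension.extVanishes_of_last [IsNoetherianRing A] [Module.Finite A X]
    [Module.Finite A N] (hL : IsIteratedExtension A N L ρ (ℓ + 1)) (hρ : ρ 0 = 1)
    (hlt : ∑ k ∈ Finset.range ℓ, ρ k < ρ ℓ) {n : ℕ}
    (hℓ : ∀ i, n < i → ExtVanishes A X (L (ℓ + 1)) i) : ∀ i, n < i → ExtVanishes A X N i := by
  obtain ⟨m, hm⟩ := exists_subsingleton_of_localLength_le (A := A)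
    (E := fun i => Abelian.Ext (ModuleCat.of A X) (ModuleCat.of A N) (n + i)) hlt fun p _ i => by
      obtain ⟨f, g, hf, hfg, hg⟩ := hL.exists_exact ℓ (by omega)
      have h1 := extLength_succ_le_add_of_exact (X := X) p hf hfg hg (n + i)
      rw [extLength_pi, extLength_eq_zero p (hℓ (n + i + 1) (by omega)), add_zero] at h1
      exact h1.trans (hL.extLength_le p (n + i) ℓ (by omega))
  refine hL.extVanishes_of_eventually hρ hℓ (m := n + m) fun i hi => ?_
  obtain ⟨k, rfl⟩ := Nat.exists_eq_add_of_le (show n ≤ i by omega)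
  exact hm k (by omega)

end ExtLength

/-! ### Comparing the ranks of the graded pieces -/

section Multichoose

theorem sum_range_multichoose (n m : ℕ) :
    ∑ k ∈ Finset.range (m + 1), n.multichoose k = (n + 1).multichoose m := by
  induction m with
  | zero => simp
  | succ m ih => rw [Finset.sum_range_succ, ih, Nat.multichoose_succ_succ, add_comm]

/-- For ℓ > 0 both sides are adjacent binomial coefficients, in ratio ℓ to n. The bound on the
exponent in the theorem comes from here. -/
theorem sum_range_multichoose_lt {n ℓ : ℕ} (h : ℓ < n) :
    ∑ k ∈ Finset.range ℓ, n.multichoose k < n.multichoose ℓ := by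
  cases ℓ with
  | zero => simp
  | succ m =>
    rw [sum_range_multichoose, Nat.multichoose_eq, Nat.multichoose_eq,
      show n + 1 + m - 1 = n + m by omega, show n + (m + 1) - 1 = n + m by omega]
    have h1 := Nat.choose_succ_right_eq (n + m) m
    have h2 : 0 < (n + m).choose m := Nat.choose_pos (by omega)
    rw [Nat.add_sub_cancel] at h1
    by_contra! h3
    have h4 := Nat.mul_le_mul_right (m + 1) h3
    have h5 : (n + m).choose m * (m + 1) < (n + m).choose m * n := Nat.mul_lt_mul_of_pos_left h h2
    omega

end Multichoose

/-! ### Passing (SAC) to the quotient by a regular sequence -/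

section SymmetricAuslander

open TensorProduct RingTheory.Sequence Pointwise

variable {A B : Type u} [CommRing A] [CommRing B] [Algebra A B]

theorem SelfExtBoundedBy.of_bijective [IsNoetherianRing A]
    (hAB : Function.Bijective (algebraMap A B)) {d : ℕ} (hA : SelfExtBoundedBy A d) :
    SelfExtBoundedBy B d := by
  intro N _ _ _ i hi
  obtain ⟨i, rfl⟩ := Nat.exists_eq_succ_of_ne_zero (by omega : i ≠ 0)
  let : Module A N := Module.compHom N (algebraMap A B)
  have : IsScalarTower A B N := .of_algebraMap_smul fun _ _ => rfl
  have : Module.Finite A B := .of_surjective (Algebra.linearMap A B) hAB.2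
  have : Module.Finite A N := .trans B N
  have hker : RingHom.ker (algebraMap A B) = ⊥ := (RingHom.injective_iff_ker_eq_bot _).mp hAB.1
  refine (extVanishes_baseChange_iff hAB.2 i N (hker ▸ isTorIndependent_bot _ N) N .id
    Function.surjective_id (by simp)).mpr ?_
  exact (hA N _ hi).congr_right (LinearEquiv.ofBijective (Algebra.linearMap A B) hAB)

theorem SatisfiesSAC.of_bijective [IsNoetherianRing A]
    (hAB : Function.Bijective (algebraMap A B)) (hA : SatisfiesSAC A) : SatisfiesSAC B := by
  intro N _ _ _ h₁ ⟨n, h₂⟩ i hi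
  let : Module A N := Module.compHom N (algebraMap A B)
  have : IsScalarTower A B N := .of_algebraMap_smul fun _ _ => rfl
  have : Module.Finite A B := .of_surjective (Algebra.linearMap A B) hAB.2
  have : Module.Finite A N := .trans B N
  have hker : RingHom.ker (algebraMap A B) = ⊥ := (RingHom.injective_iff_ker_eq_bot _).mp hAB.1
  have key : ∀ (X : Type u) [AddCommGroup X] [Module A X] [Module B X] [IsScalarTower A B X]
      (j : ℕ), 0 < j → (ExtVanishes B N X j ↔ ExtVanishes A N X j) := by
    intro X _ _ _ _ j hj
    obtain ⟨j, rfl⟩ := Nat.exists_eq_succ_of_ne_zero hj.ne'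
    exact extVanishes_baseChange_iff hAB.2 j N (hker ▸ isTorIndependent_bot _ N) N .id
      Function.surjective_id (by simp)
  refine (key N i hi).mpr (hA N (fun j hj => ?_) ⟨n, fun j hj => ?_⟩ i hi)
  · exact ((key B j hj).mp (h₁ j hj)).congr_right
      (LinearEquiv.ofBijective (Algebra.linearMap A B) hAB).symm
  · exact (key N j (by omega)).mp (h₂ j hj)

/-- The base change of a syzygy of `N` is an extension of the syzygy over `A ⧸ (a)` by `N`. -/
theorem exists_exact_syzygy_baseChange {a : A} (hAB : Function.Surjective (algebraMap A B))
    (hker : RingHom.ker (algebraMap A B) = Ideal.span {a}) (ha : IsSMulRegular A a)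
    {N : Type u} [AddCommGroup N] [Module A N] [Module B N] [IsScalarTower A B N] {r : ℕ}
    {π : (Fin r → A) →ₗ[A] N} (hπ : Function.Surjective π) :
    ∃ (f : N →ₗ[B] B ⊗[A] LinearMap.ker π)
      (g : B ⊗[A] LinearMap.ker π →ₗ[B]
        LinearMap.ker (baseChangePresentation (B := B) LinearMap.id π)),
      Function.Injective f ∧ Function.Exact f g ∧ Function.Surjective g := by
  let p := TensorProduct.mk A B (LinearMap.ker π) 1
  have hp : Function.Surjective p := TensorProduct.mk_one_surjective_of_surjective hAB _
  have hpker := ker_mk_one_le hAB (LinearMap.ker π)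
  have hamem : a ∈ RingHom.ker (algebraMap A B) := hker ▸ Ideal.mem_span_singleton_self a
  have hs := syzygyBaseChange_surjective (B := B) (p := LinearMap.id) π hAB (by simp) hπ
  obtain ⟨g, hg⟩ := LinearMap.exists_descend hAB hp hpker
    (syzygyBaseChange (B := B) LinearMap.id π)
  -- Since a kills N, multiplication by a maps A^r into ker π. Modulo a it kills ker π, so it
  -- induces the map from N; this realizes Tor_1(B, N) = N.
  let m : (Fin r → A) →ₗ[A] LinearMap.ker π :=
    (LinearMap.lsmul A (Fin r → A) a).codRestrict _ fun v => by
      rw [LinearMap.mem_ker, LinearMap.lsmul_apply, map_smul,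
        smul_eq_zero_of_mem_ker_algebraMap hamem]
  have hm : LinearMap.ker π ≤ LinearMap.ker (p ∘ₗ m) := by
    intro v hv
    have : m v = a • (⟨v, hv⟩ : LinearMap.ker π) := rfl
    rw [LinearMap.mem_ker, LinearMap.comp_apply, this, map_smul]
    exact smul_eq_zero_of_mem_ker_algebraMap (B := B) hamem (p ⟨v, hv⟩)
  obtain ⟨f, hf⟩ := LinearMap.exists_comp_eq_of_ker_le hπ hm
  have hf' : ∀ v, f (π v) = p (m v) := LinearMap.congr_fun hf
  have hF : ∀ v w : Fin r → A, a • v = a • w → v = w := fun v w h =>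
    funext fun k => ha (congrFun h k)
  refine ⟨f.extendScalarsOfSurjective hAB, g, ?_, ?_, ?_⟩
  · change Function.Injective f
    rw [← LinearMap.ker_eq_bot, LinearMap.ker_eq_bot']
    intro y hy
    obtain ⟨v, rfl⟩ := hπ y
    rw [hf'] at hy
    have := hpker hy
    rw [hker, Submodule.ideal_span_singleton_smul, Submodule.mem_smul_pointwise_iff_exists] at this
    obtain ⟨k, -, hk⟩ := this
    rw [← hF k.1 v (congrArg Subtype.val hk)]
    exact k.2
  · intro y
    obtain ⟨k, rfl⟩ := hp y
    change g (p k) = 0 ↔ p k ∈ Set.range f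
    rw [hg]
    constructor
    · intro hk
      have h0 : (Algebra.linearMap A B).compLeft (Fin r) k.1 = 0 := congrArg Subtype.val hk
      rw [← LinearMap.mem_ker, ker_compLeft_linearMap, hker,
        Submodule.ideal_span_singleton_smul, Submodule.mem_smul_pointwise_iff_exists] at h0
      obtain ⟨v, -, hv⟩ := h0
      refine ⟨π v, ?_⟩
      rw [hf']
      exact congrArg p (Subtype.ext hv)
    · rintro ⟨y, hy⟩
      obtain ⟨v, rfl⟩ := hπ y
      rw [hf'] at hy
      rw [← hg, ← hy, hg]
      refine Subtype.ext ?_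
      change (Algebra.linearMap A B).compLeft (Fin r) (a • v) = 0
      rw [map_smul, smul_eq_zero_of_mem_ker_algebraMap hamem]
  · intro y
    obtain ⟨k, rfl⟩ := hs y
    exact ⟨p k, hg k⟩

theorem SatisfiesSAC.of_regular [IsNoetherianRing A] [IsNoetherianRing B] {a : A}
    (hAB : Function.Surjective (algebraMap A B))
    (hker : RingHom.ker (algebraMap A B) = Ideal.span {a}) (ha : IsSMulRegular A a) {d : ℕ}
    (hA : SelfExtBoundedBy A d) (h : SatisfiesSAC A) : SatisfiesSAC B := by
  intro N _ _ _ hNB ⟨n, hNN⟩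
  let : Module A N := Module.compHom N (algebraMap A B)
  have : IsScalarTower A B N := .of_algebraMap_smul fun _ _ => rfl
  have : Module.Finite A B := .of_surjective (Algebra.linearMap A B) hAB
  have : Module.Finite A N := .trans B N
  obtain ⟨r, π, hπ⟩ := Module.Finite.exists_fin' A N
  have hinj := Submodule.subtype_injective (LinearMap.ker π)
  have hex := LinearMap.exact_subtype_ker_map π
  have hMA : ∀ i, 0 < i → ExtVanishes A (LinearMap.ker π) A i := by
    intro i hi
    obtain ⟨i, rfl⟩ := Nat.exists_eq_succ_of_ne_zero hi.ne'
    exact ((extVanishes_succ_iff_of_regular hAB hker ha i N).mp (hNB _ hi)).syzygy hinj hex hπ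
  have hMB : IsExtAcyclic A B (LinearMap.ker π) := fun i hi => .of_exact_right_quotient
    (lsmul_injective_of_isSMulRegular ha) (exact_lsmul_algebraLinearMap hker) hAB
    (hMA i hi) (hMA _ (by omega))
  have hbc : ∀ i, 0 < i → (ExtVanishes B (B ⊗[A] LinearMap.ker π) N i ↔
      ExtVanishes A (LinearMap.ker π) N i) := by
    intro i hi
    obtain ⟨i, rfl⟩ := Nat.exists_eq_succ_of_ne_zero hi.ne'
    exact extVanishes_baseChange_iff hAB i _
      (hMB.isTorIndependent hAB (hA.of_regular hAB hker ha) _ _) _ _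
      (TensorProduct.mk_one_surjective_of_surjective hAB _) (ker_mk_one_le hAB _)
  have hπB := baseChangePresentation_surjective (B := B) (p := LinearMap.id) π
    Function.surjective_id hπ
  have hΩ : ∀ i, 0 < i → ExtVanishes B N N (i + 1) →
      ExtVanishes B (LinearMap.ker (baseChangePresentation (B := B) LinearMap.id π)) N i := by
    intro i hi hN
    obtain ⟨i, rfl⟩ := Nat.exists_eq_succ_of_ne_zero hi.ne'
    exact hN.syzygy (Submodule.subtype_injective _) (LinearMap.exact_subtype_ker_map _) hπB
  obtain ⟨f, g, hf, hfg, hg⟩ := exists_exact_syzygy_baseChange hAB hker ha hπ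
  have hMN : ∀ i, n < i → ExtVanishes A (LinearMap.ker π) N i := fun i hi =>
    (hbc i (by omega)).mp (.of_exact_left hf hfg hg (hNN i hi)
      (hΩ i (by omega) (hNN _ (by omega))))
  have hMM : ∀ i, n + 1 < i → ExtVanishes A (LinearMap.ker π) (LinearMap.ker π) i := by
    intro i hi
    obtain ⟨i, rfl⟩ := Nat.exists_eq_succ_of_ne_zero (by omega : i ≠ 0)
    exact .of_exact_right_sub hinj hex hπ (hMN i (by omega)) ((hMA _ (by omega)).pi_right r)
  have hMM' := h (LinearMap.ker π) hMA ⟨n + 1, hMM⟩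
  have hBN : ∀ i, 0 < i → ExtVanishes B (B ⊗[A] LinearMap.ker π) N i := fun i hi =>
    (hbc i hi).mpr (.of_exact_right_quotient hinj hex hπ ((hMA i hi).pi_right r)
      (hMM' _ (by omega)))
  -- As Ext(B ⊗ M, N) = 0 for M = ker π, vanishing in degree i follows from that of Ext^(i+1)(Ω N,
  -- N), that is, of Ext^(i+2)(N, N). Hence the descent in steps of two.
  have key : ∀ k i, 0 < i → n < i + 2 * k → ExtVanishes B N N i := by
    intro k
    induction k with
    | zero => exact fun i _ hi => hNN i (by omega)
    | succ k ih =>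
      intro i hi hik
      exact .of_exact_left_sub hf hfg hg (hBN i hi)
        (hΩ (i + 1) (by omega) (ih (i + 2) (by omega) (by omega)))
  exact fun i hi => key n i hi (by omega)

/-- The identification of `QuotSMulTop a A` with the quotient ring `A ⧸ (a)`. -/
noncomputable def quotSMulTopSelfEquiv (A : Type*) [CommRing A] (a : A) :
    QuotSMulTop a A ≃ₗ[A] A ⧸ Ideal.span {a} :=
  Submodule.quotEquivOfEq _ _ (by
    rw [← Submodule.ideal_span_singleton_smul, smul_eq_mul, Ideal.mul_top])

/-- The identification of `A ⧸ I • ⊤` with `A ⧸ I`. -/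
noncomputable def quotSMulTopIdealEquiv {A : Type*} [CommRing A] (I : Ideal A) :
    (A ⧸ (I • ⊤ : Submodule A A)) ≃ₗ[A] A ⧸ I :=
  Submodule.quotEquivOfEq _ _ (by rw [smul_eq_mul, Ideal.mul_top])

/-- The target B is an arbitrary quotient because the induction replaces A by A/(a) and keeps B. -/
theorem selfExtBoundedBy_and_satisfiesSAC_of_ker_eq_ofList {d : ℕ} (n : ℕ) :
    ∀ (A B : Type u) [CommRing A] [CommRing B] [Algebra A B] [IsNoetherianRing A] (rs : List A),
      rs.length = n → Function.Surjective (algebraMap A B) →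
      RingHom.ker (algebraMap A B) = Ideal.ofList rs → IsWeaklyRegular A rs →
      SelfExtBoundedBy A d → SelfExtBoundedBy B d ∧ (SatisfiesSAC A → SatisfiesSAC B) := by
  induction n with
  | zero =>
    intro A B _ _ _ _ rs hlen hAB hker hrs hA
    rw [List.length_eq_zero_iff.mp hlen, Ideal.ofList_nil] at hker
    have hbij : Function.Bijective (algebraMap A B) :=
      ⟨(RingHom.injective_iff_ker_eq_bot _).mpr hker, hAB⟩
    exact ⟨hA.of_bijective hbij, .of_bijective hbij⟩
  | succ n ih =>
    intro A B _ _ _ _ rs hlen hAB hker hrs hA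
    match rs with
    | a :: rs =>
      rw [isWeaklyRegular_cons_iff] at hrs
      have hsurj : Function.Surjective (algebraMap A (A ⧸ Ideal.span {a})) :=
        Ideal.Quotient.mk_surjective
      have hkera : RingHom.ker (algebraMap A (A ⧸ Ideal.span {a})) = Ideal.span {a} := by
        rw [Ideal.Quotient.algebraMap_eq, Ideal.mk_ker]
      have hle : ∀ b ∈ Ideal.span {a}, algebraMap A B b = 0 := by
        intro b hb
        rw [← RingHom.mem_ker, hker, Ideal.ofList_cons]
        exact le_sup_left (b := Ideal.ofList rs) hb
      algebraize [Ideal.Quotient.lift (Ideal.span {a}) (algebraMap A B) hle]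
      have hreg : IsWeaklyRegular (A ⧸ Ideal.span {a})
          (rs.map (algebraMap A (A ⧸ Ideal.span {a}))) := by
        rw [isWeaklyRegular_map_algebraMap_iff]
        exact ((quotSMulTopSelfEquiv A a).isWeaklyRegular_congr rs).mp hrs.2
      have h₁ := hA.of_regular hsurj hkera hrs.1
      have h₂ := ih (A ⧸ Ideal.span {a}) B (rs.map (algebraMap A (A ⧸ Ideal.span {a})))
        (by simpa using hlen) (fun b => ?_) ?_ hreg h₁
      · exact ⟨h₂.1, fun h => h₂.2 (h.of_regular hsurj hkera hrs.1 hA)⟩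
      · obtain ⟨b, rfl⟩ := hAB b
        exact ⟨Ideal.Quotient.mk _ b, rfl⟩
      · refine (Ideal.ker_quotient_lift (algebraMap A B) hle).trans ?_
        rw [hker, Ideal.map_ofList, List.map_cons, Ideal.ofList_cons, Ideal.Quotient.mk_singleton_self,
          Ideal.span_singleton_zero, bot_sup_eq]
        rfl

/-- The base change of a module along a surjection as a quotient module. -/
noncomputable def tensorEquivQuot (hAB : Function.Surjective (algebraMap A B)) (M : Type u)
    [AddCommGroup M] [Module A M] :
    (B ⊗[A] M) ≃ₗ[A] M ⧸ (RingHom.ker (algebraMap A B) • ⊤ : Submodule A M) :=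
  ((Submodule.quotEquivOfEq _ _
    (le_antisymm (Submodule.smul_top_le_ker_of_algebra _) (ker_mk_one_le hAB M))).trans
    ((TensorProduct.mk A B M 1).quotKerEquivOfSurjective
      (TensorProduct.mk_one_surjective_of_surjective hAB M))).symm

theorem HasFreePowers.isIteratedExtension {M : Type u} [AddCommGroup M] [Module A M]
    {I : Ideal A} {ℓ : ℕ} (hM : HasFreePowers I ℓ M) {ρ : ℕ → ℕ}
    (hI : ∀ j < ℓ, ∃ g : Fin (ρ j) → A, IsPowerBasis I j g) :
    IsIteratedExtension A (M ⧸ (I • ⊤ : Submodule A M))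
      (fun j => M ⧸ (I ^ j • ⊤ : Submodule A M)) ρ ℓ where
  subsingleton := by
    rw [Submodule.Quotient.subsingleton_iff]
    simp
  exists_exact j hj := by
    obtain ⟨g, hg⟩ := hI j hj
    obtain ⟨f, hf, hfg⟩ := hM.exists_exact hj hg
    exact ⟨f, _, hf, hfg, Submodule.factor_surjective _⟩

theorem IsExtAcyclic.isTorIndependent_pow [IsNoetherianRing A] [IsNoetherianRing B] {d : ℕ}
    (hAB : Function.Surjective (algebraMap A B)) (hB : SelfExtBoundedBy B d) {ℓ : ℕ}
    (hI : ∀ j < ℓ, ∃ r, ∃ g : Fin r → A, IsPowerBasis (RingHom.ker (algebraMap A B)) j g)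
    (k : ℕ) (M : Type u) [AddCommGroup M] [Module A M] (hM : IsExtAcyclic A B M) :
    IsTorIndependent (RingHom.ker (algebraMap A B) ^ ℓ) k M := by
  induction k generalizing M with
  | zero => trivial
  | succ k ih =>
    exact fun r π hπ => ⟨ker_inf_pow_smul_le hI (hM.ker_inf_smul_le π hAB hB hπ) ℓ le_rfl,
      ih _ (hM.ker π hπ)⟩

theorem IsExtAcyclic.hasFreePowers [IsNoetherianRing A] [IsNoetherianRing B] {d : ℕ}
    (hAB : Function.Surjective (algebraMap A B)) (hB : SelfExtBoundedBy B d) {ℓ : ℕ}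
    (hI : ∀ j < ℓ, ∃ r, ∃ g : Fin r → A, IsPowerBasis (RingHom.ker (algebraMap A B)) j g)
    {M : Type u} [AddCommGroup M] [Module A M] [Module.Finite A M] (hM : IsExtAcyclic A B M) :
    HasFreePowers (RingHom.ker (algebraMap A B)) ℓ M := by
  obtain ⟨r, π, hπ⟩ := Module.Finite.exists_fin' A M
  exact .of_surjective hI hπ (hM.ker_inf_smul_le π hAB hB hπ)

end SymmetricAuslander

/-! ### The implications of the theorem -/

section Main

open TensorProduct RingTheory.Sequence Pointwise

theorem ker_algebraMap_quotient {A : Type*} [CommRing A] (I : Ideal A) :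
    RingHom.ker (algebraMap A (A ⧸ I)) = I := by
  rw [Ideal.Quotient.algebraMap_eq, Ideal.mk_ker]

theorem selfExtBoundedBy_quotient_ofList {R : Type u} [CommRing R] [IsNoetherianRing R] {d : ℕ}
    (hR : SelfExtBoundedBy R d) (rs : List R) (hrs : IsWeaklyRegular R rs) :
    SelfExtBoundedBy (R ⧸ Ideal.ofList rs) d :=
  (selfExtBoundedBy_and_satisfiesSAC_of_ker_eq_ofList _ R _ rs rfl Ideal.Quotient.mk_surjective
    (ker_algebraMap_quotient _) hrs hR).1

theorem SatisfiesSAC.quotient_ofList {R : Type u} [CommRing R] [IsNoetherianRing R] {d : ℕ}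
    (hR : SelfExtBoundedBy R d) (rs : List R) (hrs : IsWeaklyRegular R rs) (h : SatisfiesSAC R) :
    SatisfiesSAC (R ⧸ Ideal.ofList rs) :=
  (selfExtBoundedBy_and_satisfiesSAC_of_ker_eq_ofList _ R _ rs rfl Ideal.Quotient.mk_surjective
    (ker_algebraMap_quotient _) hrs hR).2 h

theorem isExtAcyclic_quotient_ofList {R : Type u} [CommRing R] {M : Type u} [AddCommGroup M]
    [Module R M] (hM : IsExtAcyclic R R M) (rs : List R) (hrs : IsWeaklyRegular R rs) :
    IsExtAcyclic R (R ⧸ Ideal.ofList rs) M := fun i hi =>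
  (ExtVanishes.quot_ofList rs hrs hM i hi).congr_right (quotSMulTopIdealEquiv _)

/-- This stands in for M being maximal Cohen–Macaulay: modulo each initial segment of the sequence,
functionals into the quotient ring separate points, so the next element stays regular on M. -/
theorem isWeaklyRegular_of_isExtAcyclic {R : Type u} [CommRing R] [IsNoetherianRing R] {d : ℕ}
    (hR : SelfExtBoundedBy R d) {M : Type u} [AddCommGroup M] [Module R M] [Module.Finite R M]
    (hM : IsExtAcyclic R R M) (rs : List R) (hrs : IsWeaklyRegular R rs) :
    IsWeaklyRegular M rs := by
  refine (isWeaklyRegular_iff _ _).mpr fun i hi => ?_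
  have hi' : IsWeaklyRegular R (rs.take i) := by
    rw [← List.take_append_drop i rs, isWeaklyRegular_append_iff] at hrs
    exact hrs.1
  have hreg : IsSMulRegular (R ⧸ Ideal.ofList (rs.take i)) rs[i] :=
    ((quotSMulTopIdealEquiv _).isSMulRegular_congr _).mp (hrs.regular_mod_prev i hi)
  have key := fun m : M => (isExtAcyclic_quotient_ofList hM _ hi').mem_smul_top_of_smul_mem
    Ideal.Quotient.mk_surjective (selfExtBoundedBy_quotient_ofList hR _ hi') hreg (m := m)
  rw [ker_algebraMap_quotient] at key
  rw [isSMulRegular_on_quot_iff_lsmul_comap_le]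
  exact fun m hm => key m hm

theorem SatisfiesSAC.of_quotient_ofList_pow {R : Type u} [CommRing R] [IsLocalRing R]
    [IsNoetherianRing R] {d : ℕ} (hR : SelfExtBoundedBy R d) (rs : List R)
    (hrs : IsWeaklyRegular R rs) (hm : ∀ a ∈ rs, a ∈ IsLocalRing.maximalIdeal R) {ℓ : ℕ}
    (hℓ : 0 < ℓ) (h : SatisfiesSAC (R ⧸ Ideal.ofList rs ^ ℓ)) : SatisfiesSAC R := by
  obtain ⟨ℓ, rfl⟩ := Nat.exists_eq_succ_of_ne_zero hℓ.ne'
  intro M _ _ _ hMR ⟨n, hMM⟩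
  set Q := Ideal.ofList rs with hQ
  have hMreg := isWeaklyRegular_of_isExtAcyclic hR hMR rs hrs
  have hMT : IsExtAcyclic R (R ⧸ Q) M := isExtAcyclic_quotient_ofList hMR rs hrs
  have hT : SelfExtBoundedBy (R ⧸ Q) d := selfExtBoundedBy_quotient_ofList hR rs hrs
  have hTsurj : Function.Surjective (algebraMap R (R ⧸ Q)) := Ideal.Quotient.mk_surjective
  have hSsurj : Function.Surjective (algebraMap R (R ⧸ Q ^ (ℓ + 1))) :=
    Ideal.Quotient.mk_surjective
  have hbasis := exists_isPowerBasis rs hrs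
  have hbasis' : ∀ j < ℓ + 1, ∃ r, ∃ g : Fin r → R,
      IsPowerBasis (RingHom.ker (algebraMap R (R ⧸ Q))) j g := fun j _ => by
    rw [ker_algebraMap_quotient]
    exact ⟨_, hbasis j⟩
  have htor : ∀ k, IsTorIndependent (RingHom.ker (algebraMap R (R ⧸ Q ^ (ℓ + 1)))) k M := by
    intro k
    have := hMT.isTorIndependent_pow hTsurj hT hbasis' k
    rwa [ker_algebraMap_quotient] at this ⊢
  have hfree : HasFreePowers Q (ℓ + 1) M := by
    have := hMT.hasFreePowers hTsurj hT hbasis'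
    rwa [ker_algebraMap_quotient] at this
  have hext := hfree.isIteratedExtension fun j _ => hbasis j
  have hextR := (hasFreePowers_self Q (ℓ + 1)).isIteratedExtension fun j _ => hbasis j
  let S := R ⧸ Q ^ (ℓ + 1)
  have hbc : ∀ (X : Type u) [AddCommGroup X] [Module R X] [Module S X] [IsScalarTower R S X]
      (i : ℕ), 0 < i → (ExtVanishes S (S ⊗[R] M) X i ↔ ExtVanishes R M X i) := by
    intro X _ _ _ _ i hi
    obtain ⟨i, rfl⟩ := Nat.exists_eq_succ_of_ne_zero hi.ne'
    exact extVanishes_baseChange_iff hSsurj i M (htor _) _ _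
      (TensorProduct.mk_one_surjective_of_surjective hSsurj _) (ker_mk_one_le hSsurj _)
  let e : (S ⊗[R] M) ≃ₗ[R] M ⧸ (Q ^ (ℓ + 1) • ⊤ : Submodule R M) :=
    (tensorEquivQuot hSsurj M).trans
      (Submodule.quotEquivOfEq _ _ (by rw [ker_algebraMap_quotient]))
  have hquot := ExtVanishes.quot_ofList rs hMreg hMM
  have hS := h (S ⊗[R] M)
    (fun i hi => (hbc S i hi).mpr ((hextR.extVanishes
      (ExtVanishes.quot_ofList rs hrs hMR i hi) (ℓ + 1) le_rfl).congr_right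
        (quotSMulTopIdealEquiv _)))
    ⟨n, fun i hi => (hbc _ i (by omega)).mpr ((hext.extVanishes (hquot i hi) (ℓ + 1)
      le_rfl).congr_right e.symm)⟩
  -- Vanishing of Ext(M, M/QM) above degree n is known beforehand, so no rank comparison is needed
  -- and the exponent is unrestricted.
  have hMQ := hext.extVanishes_of_eventually (Nat.multichoose_zero_right _) (n := 0)
    (fun i hi => ((hbc _ i hi).mp (hS i hi)).congr_right e) hquot
  exact fun i hi => ExtVanishes.of_quot_ofList rs hm hMreg (hMQ i hi)

theorem IsPowerBasis.map {A B : Type*} [CommRing A] [CommRing B] {f : A →+* B}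
    (hf : Function.Surjective f) {I : Ideal A} {j r : ℕ} (hker : RingHom.ker f ≤ I ^ (j + 1))
    {g : Fin r → A} (hg : IsPowerBasis I j g) : IsPowerBasis (I.map f) j (f ∘ g) := by
  constructor
  · rw [Set.range_comp, ← Ideal.map_span, hg.1, Ideal.map_pow]
  · intro c hc
    choose c' hc' using fun k => hf (c k)
    obtain rfl : (fun k => f (c' k)) = c := funext hc'
    have h1 : f (∑ k, c' k * g k) ∈ (I ^ (j + 1)).map f := by
      rw [Ideal.map_pow, map_sum]
      simpa only [map_mul, Function.comp_apply] using hc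
    rw [← Ideal.mem_comap, Ideal.comap_map_of_surjective f hf, ← RingHom.ker_eq_comap_bot,
      sup_of_le_left hker] at h1
    exact fun k => Ideal.mem_map_of_mem f (hg.2 c' h1 k)

theorem SatisfiesSAC.of_nilpotent_ker {S T : Type u} [CommRing S] [CommRing T] [Algebra S T]
    [IsNoetherianRing S] [IsNoetherianRing T] {d : ℕ} (hST : Function.Surjective (algebraMap S T))
    (hT : SelfExtBoundedBy T d) {ρ : ℕ → ℕ} {ℓ : ℕ} (hρ : ρ 0 = 1)
    (hlt : ∑ k ∈ Finset.range ℓ, ρ k < ρ ℓ)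
    (hbasis : ∀ j < ℓ + 1, ∃ g : Fin (ρ j) → S,
      IsPowerBasis (RingHom.ker (algebraMap S T)) j g)
    (hnil : RingHom.ker (algebraMap S T) ^ (ℓ + 1) = ⊥) (h : SatisfiesSAC T) :
    SatisfiesSAC S := by
  set J := RingHom.ker (algebraMap S T) with hJ
  intro M _ _ _ hMS ⟨n, hMM⟩
  -- Nilpotency of J makes the last stage of each filtration the module itself.
  have hlast : ∀ (X : Type u) [AddCommGroup X] [Module S X],
      Nonempty ((X ⧸ (J ^ (ℓ + 1) • ⊤ : Submodule S X)) ≃ₗ[S] X) := by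
    intro X _ _
    exact ⟨Submodule.quotEquivOfEqBot _ (by rw [hnil, Submodule.bot_smul])⟩
  obtain ⟨eS⟩ := hlast S
  obtain ⟨eM⟩ := hlast M
  have hextS := (hasFreePowers_self J (ℓ + 1)).isIteratedExtension hbasis
  have hMT : IsExtAcyclic S T M := fun i hi =>
    (hextS.extVanishes_of_last hρ hlt (n := 0)
      (fun i hi => ExtVanishes.congr_right eS.symm (hMS i hi)) i hi).congr_right
      ((quotSMulTopIdealEquiv J).trans
        ((Algebra.linearMap S T).quotKerEquivOfSurjective hST))
  have hbc : ∀ (X : Type u) [AddCommGroup X] [Module S X] [Module T X] [IsScalarTower S T X]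
      (i : ℕ), 0 < i → (ExtVanishes T (T ⊗[S] M) X i ↔ ExtVanishes S M X i) := by
    intro X _ _ _ _ i hi
    obtain ⟨i, rfl⟩ := Nat.exists_eq_succ_of_ne_zero hi.ne'
    exact extVanishes_baseChange_iff hST i M (hMT.isTorIndependent hST hT _ _) _ _
      (TensorProduct.mk_one_surjective_of_surjective hST _) (ker_mk_one_le hST _)
  have hextM := (hMT.hasFreePowers hST hT fun j hj => ⟨_, hbasis j hj⟩).isIteratedExtension hbasis
  have hMQ := hextM.extVanishes_of_last hρ hlt
    (fun i hi => ExtVanishes.congr_right eM.symm (hMM i hi))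
  have hTM := h (T ⊗[S] M) (fun i hi => (hbc T i hi).mpr (hMT i hi))
    ⟨n, fun i hi => (hbc _ i (by omega)).mpr
      ((hMQ i hi).congr_right (tensorEquivQuot hST M).symm)⟩
  exact fun i hi => (hextM.extVanishes (((hbc _ i hi).mp (hTM i hi)).congr_right
    (tensorEquivQuot hST M)) (ℓ + 1) le_rfl).congr_right eM

theorem SatisfiesSAC.quotient_ofList_pow {R : Type u} [CommRing R] [IsNoetherianRing R] {d : ℕ}
    (rs : List R) (hrs : IsWeaklyRegular R rs) (hT : SelfExtBoundedBy (R ⧸ Ideal.ofList rs) d)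
    (h : SatisfiesSAC (R ⧸ Ideal.ofList rs)) {ℓ : ℕ} (hℓ : 1 ≤ ℓ) (hℓ' : ℓ ≤ rs.length) :
    SatisfiesSAC (R ⧸ Ideal.ofList rs ^ ℓ) := by
  obtain ⟨ℓ, rfl⟩ := Nat.exists_eq_succ_of_ne_zero (by omega : ℓ ≠ 0)
  set Q := Ideal.ofList rs with hQ
  algebraize [Ideal.Quotient.factor (Ideal.pow_le_self (I := Q) (Nat.succ_ne_zero ℓ))]
  have hker : RingHom.ker (algebraMap (R ⧸ Q ^ ℓ.succ) (R ⧸ Q)) =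
      Q.map (Ideal.Quotient.mk (Q ^ ℓ.succ)) := Ideal.Quotient.factor_ker _
  -- The exponent is now ℓ + 1, so `hℓ'` is the strict inequality that the rank comparison needs.
  refine .of_nilpotent_ker (ℓ := ℓ) (ρ := rs.length.multichoose)
    (Ideal.Quotient.factor_surjective _) hT (Nat.multichoose_zero_right _)
    (sum_range_multichoose_lt hℓ') (fun j hj => ?_) ?_ h
  · obtain ⟨g, hg⟩ := exists_isPowerBasis rs hrs j
    rw [hker]
    refine ⟨_, hg.map Ideal.Quotient.mk_surjective ?_⟩
    rw [Ideal.mk_ker]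
    exact Ideal.pow_le_pow_right hj
  · rw [hker, ← Ideal.map_pow, Ideal.map_quotient_self]

theorem exists_selfExtBoundedBy (R : Type u) [CommRing R] [IsGorensteinLocalRing R] :
    ∃ d, SelfExtBoundedBy R d := by
  obtain ⟨d, hd⟩ := IsGorensteinLocalRing.exists_hasInjectiveDimensionLE (R := R)
  exact ⟨d, fun N _ _ _ i hi =>
    HasInjectiveDimensionLT.subsingleton (ModuleCat.of R R) (d + 1) i hi (ModuleCat.of R N)⟩

end Main

theorem theorem4p8 (R : Type u) [CommRing R] [IsGorensteinLocalRing R]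
    (n : ℕ) (hn : 1 ≤ n) (x : Fin n → R)
    (hx : RingTheory.Sequence.IsRegular R (List.ofFn x))
    (Q : Ideal R) (hQ : Q = Ideal.span (Set.range x)) :
    List.TFAE [
      SatisfiesSAC R,
      SatisfiesSAC (R ⧸ Q),
      ∃ ℓ : ℕ, 0 < ℓ ∧ SatisfiesSAC (R ⧸ Q ^ ℓ),
      ∀ ℓ : ℕ, 1 ≤ ℓ → ℓ ≤ n → SatisfiesSAC (R ⧸ Q ^ ℓ)] := by
  obtain rfl : Q = Ideal.ofList (List.ofFn x) := by
    rw [hQ]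
    exact congrArg Ideal.span (Set.ext fun a => List.mem_ofFn.symm)
  obtain ⟨d, hR⟩ := exists_selfExtBoundedBy R
  have hrs := hx.toIsWeaklyRegular
  -- Regularity includes that Q is proper; Nakayama's lemma needs this.
  have hm : ∀ a ∈ List.ofFn x, a ∈ IsLocalRing.maximalIdeal R := by
    have hne : Ideal.ofList (List.ofFn x) ≠ ⊤ := fun h => hx.top_ne_smul (by
      rw [h, smul_eq_mul, Ideal.mul_top])
    exact fun a ha => IsLocalRing.le_maximalIdeal hne (Ideal.subset_span ha)
  tfae_have 1 → 2 := SatisfiesSAC.quotient_ofList hR _ hrs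
  tfae_have 2 → 4 := fun h ℓ hℓ hℓ' => SatisfiesSAC.quotient_ofList_pow _ hrs
    (selfExtBoundedBy_quotient_ofList hR _ hrs) h hℓ (by simpa using hℓ')
  tfae_have 4 → 3 := fun h => ⟨1, one_pos, h 1 le_rfl hn⟩
  tfae_have 3 → 1 := fun ⟨ℓ, hℓ, h⟩ => SatisfiesSAC.of_quotient_ofList_pow hR _ hrs hm hℓ h
  tfae_finish
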